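/- Let $d\in\mathbb N$, $\boldsymbol\mu\in\mathbb R^d$, let $\boldsymbol\Sigma\in\mathbb R^{d\times d}$ be symmetric positive definite, and let $p=\mathcal N(\boldsymbol\mu,\boldsymbol\Sigma)$ be the true posterior. Consider the Gaussian D-vine with order $1,\dots,d$. Its parameters are means $\boldsymbol\nu\in\mathbb R^d$, standard deviations $s_1,\dots,s_d>0$ and pair copula parameters $\eta_{j,j+t}\in(-1,1)$ for $1\le t\le d-1$, $1\le j\le d-t$; write $\boldsymbol\eta^t=(\eta_{1,t+1},\dots,\eta_{d-t,d})$ for those of tree $t$. The densities of its truncations are $$q_0(\mathbf z)=\prod_{j=1}^d \varphi(z_j;\nu_j,s_j^2),\qquad q_t(\mathbf z)=q_{t-1}(\mathbf z)\prod_{j=1}^{d-t}c\big(F_{j|D}(z_j|\mathbf z_D),F_{j+t|D}(z_{j+t}|\mathbf z_D);\eta_{j,j+t}\big),\quad D=\{j+1,\dots,j+t-1\},\quad t=1,\dots,d-1,$$ where $\varphi(\cdot;m,v)$ is the $\mathcal N(m,v)$ density, $c(\cdot,\cdot;\rho)$ is the density of the bivariate Gaussian copula with correlation $\rho$, and $F_{\cdot|D}$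 are the conditional distribution functions under $q_{t-1}$. The full D-vine distribution is $q=q_{d-1}$; $q_t$ is the D-vine in which all trees after tree $t$ are set to independence. Minimise the forward divergence stepwise: first choose $(\boldsymbol\nu,s)$ minimising $KL(p\|q_0)$ over $\boldsymbol\nu\in\mathbb R^d$ and $s\in(0,\infty)^d$; then, for $t=1,\dots,d-1$ in turn, keep $\boldsymbol\nu,s,\boldsymbol\eta^1,\dots,\boldsymbol\eta^{t-1}$ fixed and choose $\boldsymbol\eta^t$ minimising $KL(p\|q_t)$ over $(-1,1)^{d-t}$. For a covariance matrix $\mathbf M$ let $\mathbf D_{M}$ be the diagonal matrix with entries $\sqrt{M_{ii}}$ and $\mathbf R_{M}=\mathbf D_{M}^{-1}\mathbf M\mathbf D_{M}^{-1}$ its correlation matrix. **Theorem.** Such stepwise minimisers exist. For any of them, with $\boldsymbol\Psi$ the covariance matrix of the resulting $q$, the matrix $\boldsymbol\Psi$ is positive definite, $q=\mathcal N(\boldsymbol\nu,\boldsymbol\Psi)$ and the true parameters are recovered: $$\boldsymbol\nu=\boldsymbol\mu,\qquad s_j=\sqrt{\Sigma_{jj}}\ \ (1\le j\le d),\qquad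 \mathbf D_\Psi=\mathbf D_\Sigma,\qquad \mathbf R_\Psi=\mathbf R_\Sigma .$$ Moreover each $\eta_{j,j+t}$ equals the partial correlation of coordinates $j$ and $j+t$ given coordinates $j+1,\dots,j+t-1$ computed from $\mathbf R_\Sigma$ (for $t=1$: the correlation). -/

import Mathlib

open MeasureTheory ProbabilityTheory InformationTheory

open scoped ENNReal NNReal

namespace GaussianDVine

noncomputable section

/-! ### The Gaussian pair copula -/

/-- The standard normal quantile function `Φ⁻¹`. -/
def stdNormalQuantile (u : ℝ) : ℝ :=
  sInf {x : ℝ | u ≤ cdf (gaussianReal 0 1) x}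

/-- The density of the bivariate normal distribution with zero means, unit variances and
correlation `ρ`. -/
def stdBivariateNormalPDF (ρ x y : ℝ) : ℝ :=
  (2 * Real.pi * √(1 - ρ ^ 2))⁻¹ *
    Real.exp (-(x ^ 2 - 2 * ρ * x * y + y ^ 2) / (2 * (1 - ρ ^ 2)))

/-- The density `c(u, v; ρ)` of the bivariate Gaussian copula
`C(u, v; ρ) = Φ₂(Φ⁻¹(u), Φ⁻¹(v); ρ)`. -/
def gaussianCopulaPDF (ρ u v : ℝ) : ℝ :=
  stdBivariateNormalPDF ρ (stdNormalQuantile u) (stdNormalQuantile v) /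
    (gaussianPDFReal 0 1 (stdNormalQuantile u) * gaussianPDFReal 0 1 (stdNormalQuantile v))

/-! ### The Gaussian D-vine distribution -/

variable {d : ℕ}

/-- The conditional distribution function `F_{j|D}(z_j | z_D)` of the `j`-th coordinate given the
coordinates in `D`, for a random vector with joint density `f`: the coordinates outside `D` are
integrated out, those in `D` are fixed at the values they have in `z`. -/
def conditionalCDF (f : (Fin d → ℝ) → ℝ≥0∞) (j : Fin d) (D : Finset (Fin d))
    (z : Fin d → ℝ) : ℝ :=
  (lmarginal (fun _ => (volume : Measure ℝ)) Dᶜ ({w | w j ≤ z j}.indicator f) z /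
    lmarginal (fun _ => (volume : Measure ℝ)) Dᶜ f z).toReal

/-- The edges of tree `t` of the D-vine with order `1, …, d`: the pairs `(i, j)` with
`j = i + t`. The conditioning set of such an edge consists of the indices strictly between
`i` and `j`. -/
def treeEdges (d t : ℕ) : Finset (Fin d × Fin d) :=
  Finset.univ.filter fun e => (e.1 : ℕ) + t = (e.2 : ℕ)

/-- The density of the Gaussian D-vine truncated at level `τ`, with marginals `N(ν j, (s j) ^ 2)`
and with pair copula parameters `η i j = η_{i, j; i+1 : j-1}` for `i < j` (the other entries of
`η` are never used). Level `0` is the mean-field density; tree `t + 1` multiplies by the Gaussian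
pair copula densities of its edges, evaluated at the conditional distribution functions under the
trees up to `t`. -/
def vineDensity (ν : EuclideanSpace ℝ (Fin d)) (s : Fin d → ℝ) (η : Fin d → Fin d → ℝ) :
    ℕ → (Fin d → ℝ) → ℝ≥0∞
  | 0 => fun z => ∏ j, gaussianPDF (ν j) ⟨s j ^ 2, sq_nonneg (s j)⟩ (z j)
  | t + 1 => fun z => vineDensity ν s η t z *
      ∏ e ∈ treeEdges d (t + 1), ENNReal.ofReal (gaussianCopulaPDF (η e.1 e.2)
        (conditionalCDF (vineDensity ν s η t) e.1 (Finset.Ioo e.1 e.2) z)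
        (conditionalCDF (vineDensity ν s η t) e.2 (Finset.Ioo e.1 e.2) z))

/-- The Gaussian D-vine distribution truncated at level `τ`; the full one has `τ = d - 1`. -/
def vine (ν : EuclideanSpace ℝ (Fin d)) (s : Fin d → ℝ) (η : Fin d → Fin d → ℝ) (τ : ℕ) :
    Measure (EuclideanSpace ℝ (Fin d)) :=
  (volume : Measure (EuclideanSpace ℝ (Fin d))).withDensity
    fun z => vineDensity ν s η τ (fun j => z j)

/-- Admissible pair copula parameters: every `η_{i, j; i+1 : j-1}` lies in `(-1, 1)`. -/
def Admissible (η : Fin d → Fin d → ℝ) : Prop :=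
  ∀ i j : Fin d, i < j → η i j ∈ Set.Ioo (-1 : ℝ) 1

/-! ### Stepwise minimisation of the forward Kullback-Leibler divergence -/

/-- The parameters `(ν, s, η)` are obtained by minimising the forward divergence `KL(p‖q)`
stepwise. First the marginal parameters minimise it over all mean-field Gaussians. Then, for
`t = 1, …, d - 1`, the parameters of tree `t` minimise it over the D-vines truncated at level `t`,
with the marginals and the earlier trees kept fixed. -/
structure IsStepwiseForwardKLMinimizer (p : Measure (EuclideanSpace ℝ (Fin d)))
    (ν : EuclideanSpace ℝ (Fin d)) (s : Fin d → ℝ) (η : Fin d → Fin d → ℝ) : Prop where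
  s_pos : ∀ j, 0 < s j
  admissible : Admissible η
  marginals_min : ∀ (ν' : EuclideanSpace ℝ (Fin d)) (s' : Fin d → ℝ), (∀ j, 0 < s' j) →
    klDiv p (vine ν s η 0) ≤ klDiv p (vine ν' s' η 0)
  tree_min : ∀ t : ℕ, 1 ≤ t → t ≤ d - 1 → ∀ η' : Fin d → Fin d → ℝ, Admissible η' →
    (∀ i j : Fin d, (i : ℕ) + t ≠ (j : ℕ) → η' i j = η i j) →
    klDiv p (vine ν s η t) ≤ klDiv p (vine ν s η' t)

/-! ### Covariance, standard deviations, correlations and partial correlations -/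

/-- The covariance matrix of a distribution on `ℝᵈ`. -/
def covMatrix (q : Measure (EuclideanSpace ℝ (Fin d))) : Matrix (Fin d) (Fin d) ℝ :=
  Matrix.of fun i j => cov[fun z : EuclideanSpace ℝ (Fin d) => z i, fun z => z j; q]

/-- The diagonal matrix `D_S` of standard deviations belonging to a covariance matrix `S`. -/
def stdMatrix (S : Matrix (Fin d) (Fin d) ℝ) : Matrix (Fin d) (Fin d) ℝ :=
  Matrix.diagonal fun i => √(S i i)

/-- The correlation matrix `R_S` belonging to a covariance matrix `S`. -/
def corrMatrix (S : Matrix (Fin d) (Fin d) ℝ) : Matrix (Fin d) (Fin d) ℝ :=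
  Matrix.of fun i j => S i j / (√(S i i) * √(S j j))

/-- The partial covariance `R_{ij} - R_{i,D} R_{D,D}⁻¹ R_{D,j}`. -/
def partialCov (R : Matrix (Fin d) (Fin d) ℝ) (D : Finset (Fin d)) (i j : Fin d) : ℝ :=
  R i j - (fun k : D => R i k) ⬝ᵥ
    ((R.submatrix (fun k : D => (k : Fin d)) (fun k : D => (k : Fin d)))⁻¹.mulVec
      fun k : D => R k j)

/-- The partial correlation of the coordinates `i` and `j` given those in `D`. -/
def partialCorr (R : Matrix (Fin d) (Fin d) ℝ) (D : Finset (Fin d)) (i j : Fin d) : ℝ :=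
  partialCov R D i j / √(partialCov R D i i * partialCov R D j j)

end

end GaussianDVine

/-! Minimising the forward divergence over a family of densities means maximising the expected log
density under `p = N(μ, S)`. At each step this expectation splits into one-parameter problems, each
with the true value as its unique solution.

The mean-field step is a sum of terms `normalScore`, each maximal exactly at the true mean and
variance. For the trees, let `blockPDF … t` be the density of the Markov chain of order `t` whose
blocks of `t + 1` consecutive coordinates have the law they have under `p`. If all trees up to `t`
carry the partial correlations of `S`, the truncated vine has exactly this density
(`vineDensity_eq_blockPDF`): the factor by which an edge corrects conditional independence is a
Gaussian copula density with the partial correlation as parameter (`pairRatio_eq_scoreCopulaPDF`).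

The conditional distribution functions needed in tree `t + 1` involve `t + 1` consecutive
coordinates only, so they are those of `p` (`lmarginal_blockPDF`, `conditionalCDF_eq`) and do not
depend on the parameters of that tree. Hence with arbitrary parameters in tree `t + 1` the density
is `blockPDF` times copula densities at standardised regression residuals (`vineDensity_succ`). It
has total mass one (`lintegral_blockPDF_mul_edgeCopula`), and its expected log density is a constant
plus one `copulaScore` per edge (`klDiv_tree_le_iff`). By `copulaScore_le` each score has its unique
maximum at the partial correlation, so induction on the tree determines all parameters. At `t = d -
1` the Markov restriction is void and the vine is `p` itself. -/

namespace GaussianDVine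
noncomputable section

/-! ### Linear regression and Schur complements for a positive definite matrix -/

section LinearAlgebra

set_option linter.unusedSectionVars false

open Matrix

variable {ι : Type*} [Fintype ι] [DecidableEq ι]

/-- The vector `v` supported on `D` such that `S v` agrees with `y` on `D`. -/
def subSolve (S : Matrix ι ι ℝ) (D : Finset ι) (y : ι → ℝ) (k : ι) : ℝ :=
  if h : k ∈ D then
    ((S.submatrix (fun k : D => (k : ι)) (fun k : D => (k : ι)))⁻¹ *ᵥ fun l : D => y l) ⟨k, h⟩
  else 0

/-- The residual of the linear regression of the coordinate `j` on the coordinates in `D`. -/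
def resid (S : Matrix ι ι ℝ) (D : Finset ι) (j : ι) (y : ι → ℝ) : ℝ :=
  y j - ∑ k, subSolve S D (fun k => S k j) k * y k

/-- The quadratic form of the inverse of the principal submatrix of `S` with indices in `D`. -/
def subQuad (S : Matrix ι ι ℝ) (D : Finset ι) (y : ι → ℝ) : ℝ :=
  ∑ k, subSolve S D y k * y k

/-- The covariance of the residuals of the coordinates `i` and `j` given those in `D`. -/
def residCov (S : Matrix ι ι ℝ) (D : Finset ι) (i j : ι) : ℝ :=
  resid S D j (fun k => S i k)

variable {S : Matrix ι ι ℝ} {D : Finset ι}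

theorem subSolve_of_notMem {k : ι} (hk : k ∉ D) (y : ι → ℝ) : subSolve S D y k = 0 := by
  simp [subSolve, hk]

theorem sum_mul_eq_sum_subtype {v : ι → ℝ} (hv : ∀ k ∉ D, v k = 0) (w : ι → ℝ) :
    ∑ k, v k * w k = ∑ k : D, v k * w k := by
  rw [Finset.sum_coe_sort D (fun k => v k * w k)]
  exact (Finset.sum_subset (Finset.subset_univ D) fun k _ hk => by simp [hv k hk]).symm

theorem posDef_principal (hS : S.PosDef) (D : Finset ι) :
    (S.submatrix (fun k : D => (k : ι)) (fun k : D => (k : ι))).PosDef :=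
  hS.submatrix Subtype.val_injective

theorem mulVec_subSolve (hS : S.PosDef) {k : ι} (hk : k ∈ D) (y : ι → ℝ) :
    ∑ l, S k l * subSolve S D y l = y k := by
  have h0 : ∑ l, S k l * subSolve S D y l = ∑ l : D, S k l * subSolve S D y l := by
    simpa only [mul_comm] using
      sum_mul_eq_sum_subtype (fun l hl => subSolve_of_notMem (S := S) hl y) (S k)
  set A := S.submatrix (fun k : D => (k : ι)) (fun k : D => (k : ι)) with hA
  have hu : IsUnit A.det := (posDef_principal hS D).det_pos.ne'.isUnit
  have h1 := congrFun (congrArg (fun B => B *ᵥ fun l : D => y l) (Matrix.mul_nonsing_inv A hu))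
    ⟨k, hk⟩
  simp only [← Matrix.mulVec_mulVec, Matrix.one_mulVec] at h1
  rw [h0, ← h1]
  simp [Matrix.mulVec, dotProduct, subSolve, hA]

/-- At every index either `v` or `S v` vanishes, so the quadratic form of `S` is zero at `v`.
Through `subSolve_unique` this lets solutions be recognised by their equations, without computing
inverses. -/
theorem eq_zero_of_mulVec_eq_zero (hS : S.PosDef) {v : ι → ℝ} (hv : ∀ k ∉ D, v k = 0)
    (h : ∀ k ∈ D, ∑ l, S k l * v l = 0) : v = 0 := by
  by_contra hne
  have h1 := hS.dotProduct_mulVec_pos hne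
  have h2 : star v ⬝ᵥ S *ᵥ v = 0 := by
    simp only [dotProduct, Matrix.mulVec]
    refine Finset.sum_eq_zero fun k _ => ?_
    by_cases hk : k ∈ D
    · rw [h k hk, mul_zero]
    · simp [hv k hk]
  exact h1.ne' h2

theorem subSolve_unique (hS : S.PosDef) {v y : ι → ℝ} (hv : ∀ k ∉ D, v k = 0)
    (h : ∀ k ∈ D, ∑ l, S k l * v l = y k) : subSolve S D y = v := by
  have := eq_zero_of_mulVec_eq_zero (D := D) hS (v := subSolve S D y - v)
    (fun k hk => by simp [hv k hk, subSolve_of_notMem hk])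
    (fun k hk => by
      simp [mul_sub, Finset.sum_sub_distrib, mulVec_subSolve hS hk, h k hk])
  exact sub_eq_zero.mp this

theorem subSolve_congr {y y' : ι → ℝ} (h : ∀ k ∈ D, y k = y' k) :
    subSolve S D y = subSolve S D y' := by
  have : (fun l : D => y l) = fun l : D => y' l := funext fun l => h l l.2
  ext k
  simp only [subSolve, this]

theorem subQuad_congr {y y' : ι → ℝ} (h : ∀ k ∈ D, y k = y' k) :
    subQuad S D y = subQuad S D y' := by
  unfold subQuad
  rw [subSolve_congr h]
  refine Finset.sum_congr rfl fun k _ => ?_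
  by_cases hk : k ∈ D
  · rw [h k hk]
  · simp [subSolve_of_notMem hk]

theorem resid_congr {j : ι} {y y' : ι → ℝ} (hj : y j = y' j) (h : ∀ k ∈ D, y k = y' k) :
    resid S D j y = resid S D j y' := by
  unfold resid
  rw [hj]
  congr 1
  refine Finset.sum_congr rfl fun k _ => ?_
  by_cases hk : k ∈ D
  · rw [h k hk]
  · simp [subSolve_of_notMem hk]

/-- Both sides are the symmetric bilinear form of `S` at `v` and `subSolve S D y`, one with the
equations for `y` inserted, the other with those for `w`. -/
theorem sum_mul_subSolve_comm (hS : S.PosDef) {v w : ι → ℝ} (hv : ∀ k ∉ D, v k = 0)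
    (y : ι → ℝ) (h : ∀ k ∈ D, ∑ l, S k l * v l = w k) :
    ∑ k, v k * y k = ∑ k, subSolve S D y k * w k := by
  have e1 : ∑ k, v k * y k = ∑ k, v k * ∑ l, S k l * subSolve S D y l := by
    refine Finset.sum_congr rfl fun k _ => ?_
    by_cases hk : k ∈ D
    · rw [mulVec_subSolve hS hk]
    · simp [hv k hk]
  have e2 : ∑ k, subSolve S D y k * w k = ∑ k, subSolve S D y k * ∑ l, S k l * v l := by
    refine Finset.sum_congr rfl fun k _ => ?_
    by_cases hk : k ∈ D
    · rw [h k hk]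
    · simp [subSolve_of_notMem hk]
  rw [e1, e2]
  simp only [Finset.mul_sum]
  rw [Finset.sum_comm]
  refine Finset.sum_congr rfl fun k _ => Finset.sum_congr rfl fun l _ => ?_
  have : S l k = S k l := by simpa using hS.isHermitian.apply k l
  rw [this]; ring

theorem posDef_symm (hS : S.PosDef) (k l : ι) : S k l = S l k := by
  simpa using hS.isHermitian.apply l k

/-- The regression coefficients of `j` on `D` pair with `y` as `S (·, j)` pairs with the solution
of the system with right hand side `y`. -/
theorem sum_coeff_mul (hS : S.PosDef) (j : ι) (y : ι → ℝ) :
    ∑ k, subSolve S D (fun k => S k j) k * y k = ∑ k, S j k * subSolve S D y k := by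
  rw [sum_mul_subSolve_comm hS (fun k hk => subSolve_of_notMem hk _) y
    (fun k hk => mulVec_subSolve hS hk _)]
  refine Finset.sum_congr rfl fun k _ => ?_
  rw [posDef_symm hS k j, mul_comm]

theorem residCov_eq (S : Matrix ι ι ℝ) (D : Finset ι) (i j : ι) :
    residCov S D i j = S i j - ∑ k, S i k * subSolve S D (fun k => S k j) k := by
  unfold residCov resid
  congr 1
  exact Finset.sum_congr rfl fun k _ => mul_comm _ _

theorem residCov_comm (hS : S.PosDef) (D : Finset ι) (i j : ι) :
    residCov S D i j = residCov S D j i := by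
  rw [residCov_eq, residCov, resid, ← sum_coeff_mul hS, posDef_symm hS i j]
  congr 1
  refine Finset.sum_congr rfl fun k _ => ?_
  rw [posDef_symm hS j k]

theorem residCov_eq_zero (hS : S.PosDef) {i : ι} (hi : i ∈ D) (j : ι) :
    residCov S D i j = 0 := by
  rw [residCov_eq, mulVec_subSolve hS hi, sub_self]

/-- The coefficients of the residual as a linear form. -/
def residVec (S : Matrix ι ι ℝ) (D : Finset ι) (j : ι) : ι → ℝ :=
  Pi.single j 1 - subSolve S D (fun k => S k j)

theorem resid_eq_sum (j : ι) (y : ι → ℝ) :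
    resid S D j y = ∑ k, residVec S D j k * y k := by
  simp [resid, residVec, sub_mul, Finset.sum_sub_distrib, Pi.single_apply]

theorem mulVec_residVec (k j : ι) :
    ∑ l, S k l * residVec S D j l = residCov S D k j := by
  simp [residCov_eq, residVec, mul_sub, Finset.sum_sub_distrib, Pi.single_apply]

/-- A residual is uncorrelated with the regressors in `D`, so only the unit-vector part of `residVec
S D i` contributes. -/
theorem sum_residVec_mul_residVec (hS : S.PosDef) (D : Finset ι) (i j : ι) :
    ∑ k, ∑ l, residVec S D i k * S k l * residVec S D j l = residCov S D i j := by
  have : ∀ k, ∑ l, residVec S D i k * S k l * residVec S D j l =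
      residVec S D i k * residCov S D k j := fun k => by
    rw [← mulVec_residVec k, Finset.mul_sum]
    exact Finset.sum_congr rfl fun l _ => by ring
  simp only [this]
  simp only [residVec, Pi.sub_apply, sub_mul, Finset.sum_sub_distrib]
  rw [Finset.sum_eq_zero (f := fun k => subSolve S D (fun k => S k i) k * residCov S D k j)]
  · simp [Pi.single_apply]
  · intro k _
    by_cases hk : k ∈ D
    · rw [residCov_eq_zero hS hk, mul_zero]
    · rw [subSolve_of_notMem hk, zero_mul]

theorem residVec_self {j : ι} (hj : j ∉ D) : residVec S D j j = 1 := by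
  simp [residVec, subSolve_of_notMem hj]

theorem residCov_self_pos (hS : S.PosDef) {j : ι} (hj : j ∉ D) : 0 < residCov S D j j := by
  rw [← sum_residVec_mul_residVec hS]
  have hne : residVec S D j ≠ 0 := fun h => by
    have := residVec_self (S := S) hj
    simp [h] at this
  have := hS.dotProduct_mulVec_pos hne
  simp only [dotProduct, Matrix.mulVec, star_trivial, Finset.mul_sum] at this
  simpa only [mul_assoc] using this

/-- `S` maps `residVec S D j` to a vector vanishing on `D`, so adding a multiple of it keeps the old
equations. The new equation in row `j` fixes the multiple. -/
theorem subSolve_insert (hS : S.PosDef) {j : ι} (hj : j ∉ D) (y : ι → ℝ) :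
    subSolve S (insert j D) y =
      subSolve S D y + (resid S D j y / residCov S D j j) • residVec S D j := by
  apply subSolve_unique hS
  · intro k hk
    rw [Finset.mem_insert, not_or] at hk
    simp [residVec, subSolve_of_notMem hk.2, hk.1]
  · intro k hk
    have e : ∑ l, S k l * (subSolve S D y + (resid S D j y / residCov S D j j) •
        residVec S D j) l = ∑ l, S k l * subSolve S D y l +
          (resid S D j y / residCov S D j j) * residCov S D k j := by
      rw [← mulVec_residVec k, Finset.mul_sum, ← Finset.sum_add_distrib]
      refine Finset.sum_congr rfl fun l _ => ?_
      simp only [Pi.add_apply, Pi.smul_apply, smul_eq_mul]; ring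
    rw [e]
    rcases Finset.mem_insert.mp hk with rfl | hk
    · rw [div_mul_cancel₀ _ (residCov_self_pos hS hj).ne', ← sum_coeff_mul hS, resid]
      ring
    · rw [mulVec_subSolve hS hk, residCov_eq_zero hS hk, mul_zero, add_zero]

theorem subQuad_insert (hS : S.PosDef) {j : ι} (hj : j ∉ D) (y : ι → ℝ) :
    subQuad S (insert j D) y = subQuad S D y + resid S D j y ^ 2 / residCov S D j j := by
  unfold subQuad
  rw [subSolve_insert hS hj]
  simp only [Pi.add_apply, Pi.smul_apply, smul_eq_mul, add_mul, Finset.sum_add_distrib, mul_assoc]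
  rw [← Finset.mul_sum, ← resid_eq_sum]
  ring

/-- A Gram–Schmidt step: regressing additionally on `i` amounts to regressing the residual of `j` on
that of `i`. -/
theorem resid_insert (hS : S.PosDef) {i : ι} (hi : i ∉ D) (j : ι) (y : ι → ℝ) :
    resid S (insert i D) j y =
      resid S D j y - residCov S D i j / residCov S D i i * resid S D i y := by
  conv_lhs => rw [resid, subSolve_insert hS hi]
  simp only [Pi.add_apply, Pi.smul_apply, smul_eq_mul, add_mul, Finset.sum_add_distrib, mul_assoc]
  rw [← Finset.mul_sum, ← resid_eq_sum, resid]
  have h1 (k : ι) : S k j = S j k := posDef_symm hS k j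
  rw [residCov_comm hS D i j]
  simp only [residCov, resid, h1]
  ring

theorem residCov_insert_self (hS : S.PosDef) {i : ι} (hi : i ∉ D) (j : ι) :
    residCov S (insert i D) j j =
      residCov S D j j - residCov S D i j ^ 2 / residCov S D i i := by
  rw [residCov, resid_insert hS hi, ← residCov, ← residCov, residCov_comm hS D j i]
  ring

theorem residCov_empty (i j : ι) : residCov S ∅ i j = S i j := by
  simp [residCov, resid, subSolve]

theorem resid_empty (j : ι) (y : ι → ℝ) : resid S ∅ j y = y j := by
  simp [resid, subSolve]

theorem subQuad_empty (y : ι → ℝ) : subQuad S ∅ y = 0 := by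
  simp [subQuad, subSolve]

theorem subQuad_univ (hS : S.PosDef) (y : ι → ℝ) : subQuad S Finset.univ y = y ⬝ᵥ S⁻¹ *ᵥ y := by
  have : subSolve S Finset.univ y = S⁻¹ *ᵥ y := by
    apply subSolve_unique hS (by simp)
    intro k _
    have hu : IsUnit S.det := hS.det_pos.ne'.isUnit
    have h1 := congrFun (congrArg (fun B => B *ᵥ y) (Matrix.mul_nonsing_inv S hu)) k
    simp only [← Matrix.mulVec_mulVec, Matrix.one_mulVec] at h1
    exact h1
  rw [subQuad, this, dotProduct_comm]
  rfl

theorem partialCov_eq_residCov {d : ℕ} (S : Matrix (Fin d) (Fin d) ℝ)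
    (D : Finset (Fin d)) (i j : Fin d) : partialCov S D i j = residCov S D i j := by
  rw [residCov_eq, partialCov]
  congr 1
  have := sum_mul_eq_sum_subtype (D := D)
    (fun k hk => subSolve_of_notMem (S := S) hk (fun k => S k j)) (S i)
  simp only [mul_comm (S i _)]
  rw [this]
  simp only [dotProduct]
  refine Finset.sum_congr rfl fun k _ => ?_
  rw [mul_comm]
  congr 1
  simp [subSolve]

/-- The determinant of the principal submatrix with indices in `D`. -/
def subDet (S : Matrix ι ι ℝ) (D : Finset ι) : ℝ :=
  (S.submatrix (fun k : D => (k : ι)) (fun k : D => (k : ι))).det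

theorem subDet_pos (hS : S.PosDef) (D : Finset ι) : 0 < subDet S D :=
  (posDef_principal hS D).det_pos

theorem subDet_empty : subDet S ∅ = 1 := by simp [subDet]

theorem subDet_univ : subDet S Finset.univ = S.det :=
  Matrix.det_submatrix_equiv_self (Equiv.subtypeUnivEquiv Finset.mem_univ) S

/-- The residual variance is the Schur complement of the block `D` in the matrix bordered by row and
column `j`. -/
theorem subDet_insert (hS : S.PosDef) {j : ι} (hj : j ∉ D) :
    subDet S (insert j D) = subDet S D * residCov S D j j := by
  let e : D ⊕ Unit ≃ (insert j D : Finset ι) :=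
    (Equiv.optionEquivSumPUnit D).symm.trans (Finset.subtypeInsertEquivOption hj).symm
  have hu : IsUnit (S.submatrix (fun k : D => (k : ι)) (fun k : D => (k : ι))).det :=
    (subDet_pos hS D).ne'.isUnit
  let _ := Matrix.invertibleOfIsUnitDet _ hu
  have h1 : ((S.submatrix (fun k : (insert j D : Finset ι) => (k : ι))
      (fun k : (insert j D : Finset ι) => (k : ι))).submatrix e e) =
      fromBlocks (S.submatrix (fun k : D => (k : ι)) (fun k : D => (k : ι)))
        (Matrix.of fun k _ => S k j) (Matrix.of fun _ k => S j k) (Matrix.of fun _ _ => S j j) := by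
    ext (a | a) (b | b) <;> simp [e, Finset.subtypeInsertEquivOption]
  rw [subDet, ← Matrix.det_submatrix_equiv_self e, h1, Matrix.det_fromBlocks₁₁, ← subDet]
  congr 1
  rw [Matrix.det_unique, residCov_eq, Matrix.invOf_eq_nonsing_inv]
  simp only [Matrix.sub_apply, Matrix.of_apply]
  congr 1
  have := sum_mul_eq_sum_subtype (D := D)
    (fun k hk => subSolve_of_notMem (S := S) hk (fun k => S k j)) (S j)
  simp only [mul_comm (S j _)]
  rw [this, Matrix.mul_assoc, Matrix.mul_apply]
  refine Finset.sum_congr rfl fun k _ => ?_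
  rw [Matrix.of_apply, mul_comm]
  congr 1
  simp [subSolve, Matrix.mul_apply, Matrix.mulVec, dotProduct]

end LinearAlgebra

/-! ### Normal marginal densities and the density of `multivariateGaussian` -/

section MarginalDensity

set_option linter.unusedSectionVars false

variable {ι : Type*} [Fintype ι] [DecidableEq ι] {m : ι → ℝ} {S : Matrix ι ι ℝ} {D : Finset ι}

/-- The joint density of the coordinates in `D` under the normal distribution with mean `m` and
covariance matrix `S`. -/
def margPDF (m : ι → ℝ) (S : Matrix ι ι ℝ) (D : Finset ι) (z : ι → ℝ) : ℝ :=
  (√((2 * Real.pi) ^ D.card * subDet S D))⁻¹ * Real.exp (-subQuad S D (z - m) / 2)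

theorem margPDF_pos (hS : S.PosDef) (z : ι → ℝ) : 0 < margPDF m S D z := by
  have := subDet_pos hS D
  unfold margPDF
  positivity

theorem margPDF_empty (z : ι → ℝ) : margPDF m S ∅ z = 1 := by
  simp [margPDF, subDet_empty, subQuad_empty]

theorem margPDF_congr {z z' : ι → ℝ} (h : ∀ k ∈ D, z k = z' k) :
    margPDF m S D z = margPDF m S D z' := by
  unfold margPDF
  rw [subQuad_congr (y' := z' - m) fun k hk => by simp [h k hk]]

theorem margPDF_update {j : ι} (hj : j ∉ D) (z : ι → ℝ) (x : ℝ) :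
    margPDF m S D (Function.update z j x) = margPDF m S D z :=
  margPDF_congr fun k hk => by
    rw [Function.update_of_ne]; rintro rfl; exact hj hk

/-- The chain rule for densities: determinant and quadratic form each split off the contribution of
the residual of `j`. -/
theorem margPDF_insert (hS : S.PosDef) {j : ι} (hj : j ∉ D) (z : ι → ℝ) :
    margPDF m S (insert j D) z = margPDF m S D z *
      gaussianPDFReal 0 (residCov S D j j).toNNReal (resid S D j (z - m)) := by
  have h1 := residCov_self_pos hS hj
  have h2 := subDet_pos hS D
  unfold margPDF
  rw [gaussianPDFReal, Real.coe_toNNReal _ h1.le, Finset.card_insert_of_notMem hj,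
    subDet_insert hS hj, subQuad_insert hS hj,
    show (2 * Real.pi) ^ (D.card + 1) * (subDet S D * residCov S D j j) =
      ((2 * Real.pi) ^ D.card * subDet S D) * (2 * Real.pi * residCov S D j j) by ring,
    Real.sqrt_mul (by positivity), mul_inv, mul_mul_mul_comm, ← Real.exp_add]
  congr 2
  field_simp
  ring

theorem measurable_subSolve (k : ι) : Measurable fun y : ι → ℝ => subSolve S D y k := by
  unfold subSolve
  split_ifs
  · simp only [Matrix.mulVec, dotProduct]
    fun_prop
  · fun_prop

theorem measurable_resid (j : ι) : Measurable fun y : ι → ℝ => resid S D j y := by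
  unfold resid
  fun_prop

theorem measurable_margPDF : Measurable (margPDF m S D) := by
  have (k : ι) := (measurable_subSolve (S := S) (D := D) k).comp (measurable_id.sub_const m)
  unfold margPDF subQuad
  refine Measurable.const_mul (Real.measurable_exp.comp (Measurable.div_const
    (Measurable.neg (Finset.measurable_sum _ fun k _ => (this k).mul ?_)) _)) _
  simp only [Pi.sub_apply]
  fun_prop

/-- The mean of the coordinate `j` given that the coordinates in `D` are those of `z`. -/
def condMean (m : ι → ℝ) (S : Matrix ι ι ℝ) (D : Finset ι) (j : ι) (z : ι → ℝ) : ℝ :=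
  z j - resid S D j (z - m)

theorem resid_eq_sub_condMean (j : ι) (z : ι → ℝ) :
    resid S D j (z - m) = z j - condMean m S D j z := by
  simp [condMean]

theorem condMean_congr (j : ι) {z z' : ι → ℝ} (h : ∀ k ∈ D, z k = z' k) :
    condMean m S D j z = condMean m S D j z' := by
  have : ∑ k, subSolve S D (fun k => S k j) k * (z k - m k) =
      ∑ k, subSolve S D (fun k => S k j) k * (z' k - m k) := by
    refine Finset.sum_congr rfl fun k _ => ?_
    by_cases hk : k ∈ D
    · rw [h k hk]
    · simp [subSolve_of_notMem hk]
  simp only [condMean, resid, Pi.sub_apply, this]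
  ring

theorem resid_update {j : ι} (hj : j ∉ D) (z : ι → ℝ) (x : ℝ) :
    resid S D j (Function.update z j x - m) = x - condMean m S D j z := by
  rw [resid_eq_sub_condMean, Function.update_self, condMean_congr (z' := z)]
  intro k hk
  rw [Function.update_of_ne]; rintro rfl; exact hj hk

theorem margPDF_insert_update (hS : S.PosDef) {j : ι} (hj : j ∉ D) (z : ι → ℝ) (x : ℝ) :
    margPDF m S (insert j D) (Function.update z j x) = margPDF m S D z *
      gaussianPDFReal (condMean m S D j z) (residCov S D j j).toNNReal x := by
  rw [margPDF_insert hS hj, margPDF_update hj, resid_update hj, gaussianPDFReal_sub, zero_add]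

/-- The quotient is the conditional density of coordinate `j` given `D`. Coordinates of the Markov
densities below are integrated out one at a time by this fact. -/
theorem lintegral_margPDF_insert_div (hS : S.PosDef) {j : ι} (hj : j ∉ D) (z : ι → ℝ) :
    ∫⁻ x, ENNReal.ofReal (margPDF m S (insert j D) (Function.update z j x) /
      margPDF m S D (Function.update z j x)) = 1 := by
  have (x : ℝ) : margPDF m S (insert j D) (Function.update z j x) /
      margPDF m S D (Function.update z j x) =
      gaussianPDFReal (condMean m S D j z) (residCov S D j j).toNNReal x := by
    rw [margPDF_insert_update hS hj, margPDF_update hj,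
      mul_div_cancel_left₀ _ (margPDF_pos hS z).ne']
  simp only [this]
  exact lintegral_gaussianPDFReal_eq_one _ (by simpa using residCov_self_pos hS hj)

theorem lmarginal_prod (f : ι → ℝ → ℝ≥0∞) (hf : ∀ i, Measurable (f i)) (s : Finset ι)
    (x : ι → ℝ) :
    lmarginal (fun _ => (volume : Measure ℝ)) s (fun x => ∏ i ∈ s, f i (x i)) x =
      ∏ i ∈ s, ∫⁻ t, f i t := by
  induction s using Finset.induction generalizing x with
  | empty => simp
  | insert i s hi ih =>
    have hs (x : ι → ℝ) (t : ℝ) : ∏ k ∈ s, f k (Function.update x i t k) = ∏ k ∈ s, f k (x k) :=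
      Finset.prod_congr rfl fun k hk => by
        rw [Function.update_of_ne]; rintro rfl; exact hi hk
    rw [lmarginal_insert' _ (by fun_prop) hi, Finset.prod_insert hi, ← ih x]
    simp only [Finset.prod_insert hi, Function.update_self, hs]
    have (y : ι → ℝ) : ∫⁻ t, f i t * ∏ k ∈ s, f k (y k) =
        (∫⁻ t, f i t) * ∏ k ∈ s, f k (y k) := lintegral_mul_const _ (hf i)
    simp only [this, lmarginal]
    rw [lintegral_const_mul]
    refine Finset.measurable_prod _ fun k _ => (hf k).comp ?_
    exact (measurable_pi_apply (X := fun _ : ι => ℝ) k).comp measurable_updateFinset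

theorem lintegral_prod_eq_prod (f : ι → ℝ → ℝ≥0∞) (hf : ∀ i, Measurable (f i)) :
    ∫⁻ x : ι → ℝ, ∏ i, f i (x i) = ∏ i, ∫⁻ t, f i t := by
  rw [volume_pi, lintegral_eq_lmarginal_univ (X := fun _ : ι => ℝ) 0, lmarginal_prod f hf]

theorem pi_gaussianReal_eq_withDensity :
    Measure.pi (fun _ : ι => gaussianReal 0 1) =
      (volume : Measure (ι → ℝ)).withDensity fun x => ∏ i, gaussianPDF 0 1 (x i) := by
  refine (Measure.pi_eq fun s hs => ?_)
  rw [withDensity_apply _ (MeasurableSet.univ_pi hs), ← lintegral_indicator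
    (MeasurableSet.univ_pi hs)]
  have (x : ι → ℝ) : (Set.univ.pi s).indicator (fun x => ∏ i, gaussianPDF 0 1 (x i)) x =
      ∏ i, (s i).indicator (gaussianPDF 0 1) (x i) := by
    by_cases hx : x ∈ Set.univ.pi s
    · rw [Set.indicator_of_mem hx]
      exact Finset.prod_congr rfl fun i _ => by rw [Set.indicator_of_mem (hx i (Set.mem_univ i))]
    · rw [Set.indicator_of_notMem hx]
      simp only [Set.mem_univ_pi, not_forall] at hx
      obtain ⟨i, hi⟩ := hx
      exact (Finset.prod_eq_zero (Finset.mem_univ i) (Set.indicator_of_notMem hi _)).symm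
  simp only [this]
  rw [lintegral_prod_eq_prod _ fun i => (measurable_gaussianPDF 0 1).indicator (hs i)]
  refine Finset.prod_congr rfl fun i _ => ?_
  rw [lintegral_indicator (hs i), gaussianReal_apply _ one_ne_zero]

theorem map_withDensity_comp {α β : Type*} [MeasurableSpace α] [MeasurableSpace β]
    (ρ : Measure α) {F : α → β} (hF : Measurable F) {g : β → ℝ≥0∞} (hg : Measurable g) :
    (ρ.withDensity (g ∘ F)).map F = (ρ.map F).withDensity g := by
  ext s hs
  rw [Measure.map_apply hF hs, withDensity_apply _ (hF hs), withDensity_apply _ hs,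
    setLIntegral_map hs hg hF]
  rfl

-- Change of variables with the symmetric root `A` of `S`: since `A * A = S`, the quadratic form of
-- `S⁻¹` at `A x` is the squared length of `x`, and the Jacobian `|det A|` is the square root of
-- `det S`.
open scoped MatrixOrder in
theorem map_affine_pi_gaussianReal (μ : ι → ℝ) (hS : S.PosDef) :
    (Measure.pi fun _ : ι => gaussianReal 0 1).map (fun x => μ + (CFC.sqrt S).mulVec x) =
      (volume : Measure (ι → ℝ)).withDensity fun z =>
        ENNReal.ofReal (margPDF μ S Finset.univ z) := by
  set A := CFC.sqrt S with hA
  have hAA : A * A = S := CFC.sqrt_mul_sqrt_self S hS.posSemidef.nonneg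
  have hAt : A.transpose = A := by
    have := (CFC.sqrt_nonneg S).isSelfAdjoint.star_eq
    simpa [Matrix.star_eq_conjTranspose] using this
  have hdet : A.det ^ 2 = S.det := by rw [← hAA, Matrix.det_mul, sq]
  have hA0 : A.det ≠ 0 := fun h => by
    have := hS.det_pos
    rw [← hdet, h] at this; simp at this
  have hAu : IsUnit A.det := hA0.isUnit
  let F : (ι → ℝ) → ι → ℝ := fun x => μ + A.mulVec x
  have hAm : Measurable fun x : ι → ℝ => A.mulVec x := by
    refine measurable_pi_lambda _ fun i => ?_
    simp only [Matrix.mulVec, dotProduct]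
    fun_prop
  have hF : Measurable F := hAm.const_add _
  let g : (ι → ℝ) → ℝ≥0∞ := fun z => ENNReal.ofReal |A.det| *
    ENNReal.ofReal (margPDF μ S Finset.univ z)
  have hg0 : Measurable fun z => ENNReal.ofReal (margPDF μ S Finset.univ z) :=
    measurable_margPDF.ennreal_ofReal
  have hg : Measurable g := hg0.const_mul _
  have e2 : (fun x : ι → ℝ => ∏ i, gaussianPDF 0 1 (x i)) = g ∘ F := by
    funext x
    have hq : subQuad S Finset.univ (F x - μ) = ∑ i, x i ^ 2 := by
      have h1 : F x - μ = A.mulVec x := by simp [F]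
      have h2 : S⁻¹.mulVec (A.mulVec x) = A⁻¹.mulVec x := by
        rw [← hAA, Matrix.mul_inv_rev, Matrix.mulVec_mulVec, Matrix.mul_assoc,
          Matrix.nonsing_inv_mul A hAu, mul_one]
      rw [h1, subQuad_univ hS, h2, Matrix.dotProduct_mulVec, ← Matrix.mulVec_transpose,
        Matrix.transpose_nonsing_inv, hAt, Matrix.mulVec_mulVec, Matrix.nonsing_inv_mul A hAu,
        Matrix.one_mulVec]
      simp [dotProduct, sq]
    simp only [g, Function.comp, gaussianPDF]
    rw [← ENNReal.ofReal_prod_of_nonneg fun i _ => gaussianPDFReal_nonneg _ _ _,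
      ← ENNReal.ofReal_mul (abs_nonneg _)]
    congr 1
    simp only [gaussianPDFReal, margPDF, hq, Finset.prod_mul_distrib, ← Real.exp_sum, subDet_univ,
      Finset.prod_const, ← hdet]
    have hs : √((2 * Real.pi) ^ Fintype.card ι * A.det ^ 2) =
        √(2 * Real.pi) ^ Fintype.card ι * |A.det| := by
      rw [← Real.sqrt_sq (show 0 ≤ √(2 * Real.pi) ^ Fintype.card ι * |A.det| by positivity),
        mul_pow _ |A.det|, sq_abs, ← pow_mul, mul_comm _ 2, pow_mul, Real.sq_sqrt (by positivity)]
    have hA1 : |A.det| ≠ 0 := (abs_pos.mpr hA0).ne'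
    rw [Finset.card_univ, hs, ← mul_assoc]
    congr 1
    · simp only [NNReal.coe_one, mul_one, inv_pow]
      field_simp
    · congr 1
      simp [Finset.sum_div, neg_div]
  have e3 : (volume : Measure (ι → ℝ)).map F = ENNReal.ofReal |A.det⁻¹| • volume := by
    have : F = (fun x => μ + x) ∘ Matrix.toLin' A := rfl
    rw [this, ← Measure.map_map (measurable_const_add _) (by exact hAm),
      Real.map_matrix_volume_pi_eq_smul_volume_pi hA0,
      Measure.map_smul, map_add_left_eq_self]
  have e4 : ENNReal.ofReal |A.det⁻¹| * ENNReal.ofReal |A.det| = 1 := by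
    rw [← ENNReal.ofReal_mul (abs_nonneg _), ← abs_mul, inv_mul_cancel₀ hA0]; simp
  have e5 : ENNReal.ofReal |A.det⁻¹| • (volume : Measure (ι → ℝ)).withDensity g =
      volume.withDensity fun z => ENNReal.ofReal (margPDF μ S Finset.univ z) := by
    rw [show g = ENNReal.ofReal |A.det| • fun z =>
      ENNReal.ofReal (margPDF μ S Finset.univ z) from rfl,
      withDensity_smul _ hg0, smul_smul, e4, one_smul]
  rw [pi_gaussianReal_eq_withDensity, e2, map_withDensity_comp _ hF hg, e3,
    withDensity_smul_measure, e5]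

theorem map_toLp_withDensity {g : (ι → ℝ) → ℝ≥0∞} (hg : Measurable g) :
    ((volume : Measure (ι → ℝ)).withDensity g).map (WithLp.toLp 2) =
      (volume : Measure (EuclideanSpace ℝ ι)).withDensity fun z => g fun j => z j := by
  have h : Measurable fun z : EuclideanSpace ℝ ι => g fun j => z j :=
    hg.comp (PiLp.volume_preserving_ofLp ι).measurable
  rw [← (PiLp.volume_preserving_toLp ι).map_eq,
    ← map_withDensity_comp _ (PiLp.volume_preserving_toLp ι).measurable h]
  rfl

open scoped MatrixOrder in
theorem multivariateGaussian_eq_withDensity (μ : EuclideanSpace ℝ ι) (hS : S.PosDef) :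
    multivariateGaussian μ S = (volume : Measure (EuclideanSpace ℝ ι)).withDensity
      fun z => ENNReal.ofReal (margPDF (fun j => μ j) S Finset.univ (fun j => z j)) := by
  have hF : Measurable fun x : ι → ℝ => (fun j => μ j) + (CFC.sqrt S).mulVec x := by
    refine Measurable.const_add (measurable_pi_lambda _ fun i => ?_) _
    simp only [Matrix.mulVec, dotProduct]
    fun_prop
  rw [← map_toLp_withDensity measurable_margPDF.ennreal_ofReal, ← map_affine_pi_gaussianReal _ hS,
    multivariateGaussian, ← map_pi_eq_stdGaussian, Measure.map_map (by fun_prop) (by fun_prop),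
    Measure.map_map (by fun_prop) hF]
  rfl

end MarginalDensity

/-! ### Markov densities on windows of consecutive coordinates -/

section Window

variable {d : ℕ} {m : Fin d → ℝ} {S : Matrix (Fin d) (Fin d) ℝ}

/-- The window of the coordinates with index in `[a, b)`. -/
def window (d a b : ℕ) : Finset (Fin d) :=
  Finset.univ.filter fun k => a ≤ (k : ℕ) ∧ (k : ℕ) < b

theorem mem_window {a b : ℕ} {k : Fin d} : k ∈ window d a b ↔ a ≤ (k : ℕ) ∧ (k : ℕ) < b := by
  simp [window]

theorem window_eq_empty {a b : ℕ} (h : b ≤ a) : window d a b = ∅ := by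
  ext k; simp [mem_window]; omega

theorem window_eq_insert_left {a b : ℕ} (ha : a < d) (h : a < b) :
    window d a b = insert ⟨a, ha⟩ (window d (a + 1) b) := by
  ext k; simp [mem_window, Fin.ext_iff]; omega

theorem window_eq_insert_right {a b : ℕ} (hb : b < d) (h : a ≤ b) :
    window d a (b + 1) = insert ⟨b, hb⟩ (window d a b) := by
  ext k; simp [mem_window, Fin.ext_iff]; omega

theorem window_zero : window d 0 d = Finset.univ := by
  ext k; simp [mem_window]

/-- The joint density of the coordinates with index in `[a, b)`. -/
def windowPDF (m : Fin d → ℝ) (S : Matrix (Fin d) (Fin d) ℝ) (a b : ℕ) (z : Fin d → ℝ) : ℝ :=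
  margPDF m S (window d a b) z

theorem windowPDF_pos (hS : S.PosDef) (a b : ℕ) (z : Fin d → ℝ) : 0 < windowPDF m S a b z :=
  margPDF_pos hS z

theorem windowPDF_eq_one {a b : ℕ} (h : b ≤ a) (z : Fin d → ℝ) : windowPDF m S a b z = 1 := by
  rw [windowPDF, window_eq_empty h, margPDF_empty]

/-- The factor by which the joint density of the coordinates in `[i, j]` exceeds the one in which
the coordinates `i` and `j` are conditionally independent given those in between. -/
def pairRatio (m : Fin d → ℝ) (S : Matrix (Fin d) (Fin d) ℝ) (i j : ℕ) (z : Fin d → ℝ) : ℝ :=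
  windowPDF m S i (j + 1) z * windowPDF m S (i + 1) j z /
    (windowPDF m S i j z * windowPDF m S (i + 1) (j + 1) z)

theorem pairRatio_pos (hS : S.PosDef) (i j : ℕ) (z : Fin d → ℝ) : 0 < pairRatio m S i j z := by
  have h := fun a b => windowPDF_pos (m := m) hS a b z
  have := h i (j + 1); have := h (i + 1) j; have := h i j; have := h (i + 1) (j + 1)
  unfold pairRatio; positivity

/-- The density on the coordinates in `[a, b)` of the Markov chain of order `t` that has the same
distributions of `t + 1` consecutive coordinates as the normal distribution. -/
def blockPDF (m : Fin d → ℝ) (S : Matrix (Fin d) (Fin d) ℝ) (t a b : ℕ) (z : Fin d → ℝ) : ℝ :=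
  ∏ i ∈ Finset.Ico a b, ∏ j ∈ Finset.Ico a b,
    if i ≤ j ∧ j ≤ i + t then pairRatio m S i j z else 1

theorem blockPDF_pos (hS : S.PosDef) (t a b : ℕ) (z : Fin d → ℝ) : 0 < blockPDF m S t a b z := by
  refine Finset.prod_pos fun i _ => Finset.prod_pos fun j _ => ?_
  split_ifs
  · exact pairRatio_pos hS i j z
  · exact one_pos

theorem measurable_pairRatio (i j : ℕ) : Measurable (pairRatio m S i j) := by
  have h := fun a b => measurable_margPDF (m := m) (S := S) (D := window d a b)
  exact ((h _ _).mul (h _ _)).div ((h _ _).mul (h _ _))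

theorem measurable_blockPDF (t a b : ℕ) : Measurable (blockPDF m S t a b) := by
  refine Finset.measurable_prod _ fun i _ => Finset.measurable_prod _ fun j _ => ?_
  split_ifs
  · exact measurable_pairRatio i j
  · exact measurable_const

/-- The product telescopes in `j` to the conditional density of coordinate `a` given at most `t`
successors. The bound `j ≤ a + t` becomes the exclusive end `a + t + 1` of the window. -/
theorem prod_pairRatio_row (hS : S.PosDef) (t a n : ℕ) (z : Fin d → ℝ) :
    ∏ j ∈ Finset.Ico a (a + n), (if j ≤ a + t then pairRatio m S a j z else 1) =
      windowPDF m S a (min (a + n) (a + t + 1)) z /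
        windowPDF m S (a + 1) (min (a + n) (a + t + 1)) z := by
  induction n with
  | zero => simp [windowPDF_eq_one]
  | succ n ih =>
    rw [← add_assoc, Finset.prod_Ico_succ_top (by omega), ih]
    split_ifs with h
    · rw [min_eq_left (by omega), min_eq_left (by omega), pairRatio]
      have h := fun a b => (windowPDF_pos (m := m) hS a b z).ne'
      have := h a (a + n); have := h (a + 1) (a + n); have := h (a + 1) (a + n + 1)
      field_simp
    · rw [min_eq_right (by omega), min_eq_right (by omega), mul_one]

/-- The mirror image: the conditional density of coordinate `b` given at most `t` predecessors. If
`t > b` the truncated `b - t` is `0`, and the maximum is then `a`, as it should be. -/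
theorem prod_pairRatio_col (hS : S.PosDef) (t b n : ℕ) {a : ℕ} (hn : a + n = b + 1)
    (z : Fin d → ℝ) :
    ∏ i ∈ Finset.Ico a (b + 1), (if b ≤ i + t then pairRatio m S i b z else 1) =
      windowPDF m S (max a (b - t)) (b + 1) z / windowPDF m S (max a (b - t)) b z := by
  induction n generalizing a with
  | zero =>
    obtain rfl : a = b + 1 := by omega
    rw [max_eq_left (by omega)]
    simp [windowPDF_eq_one]
  | succ n ih =>
    rw [Finset.prod_eq_prod_Ico_succ_bot (by omega), ih (by omega)]
    split_ifs with h
    · rw [max_eq_left (by omega), max_eq_left (by omega), pairRatio]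
      have h := fun a b => (windowPDF_pos (m := m) hS a b z).ne'
      have := h a b; have := h (a + 1) b; have := h (a + 1) (b + 1)
      field_simp
    · rw [max_eq_right (by omega), max_eq_right (by omega), one_mul]

theorem blockPDF_succ_left (hS : S.PosDef) (t : ℕ) {a b : ℕ} (h : a < b) (z : Fin d → ℝ) :
    blockPDF m S t a b z = windowPDF m S a (min b (a + t + 1)) z /
      windowPDF m S (a + 1) (min b (a + t + 1)) z * blockPDF m S t (a + 1) b z := by
  obtain ⟨n, rfl⟩ := Nat.exists_eq_add_of_le h.le
  unfold blockPDF
  rw [Finset.prod_eq_prod_Ico_succ_bot h, ← prod_pairRatio_row hS t a n z]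
  congr 1
  · refine Finset.prod_congr rfl fun j hj => ?_
    simp [(Finset.mem_Ico.mp hj).1]
  · refine Finset.prod_congr rfl fun i hi => ?_
    rw [Finset.prod_eq_prod_Ico_succ_bot h, if_neg, one_mul]
    have := (Finset.mem_Ico.mp hi).1
    omega

theorem blockPDF_succ_right (hS : S.PosDef) (t : ℕ) {a b : ℕ} (h : a ≤ b) (z : Fin d → ℝ) :
    blockPDF m S t a (b + 1) z = windowPDF m S (max a (b - t)) (b + 1) z /
      windowPDF m S (max a (b - t)) b z * blockPDF m S t a b z := by
  unfold blockPDF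
  rw [← prod_pairRatio_col hS t b (b + 1 - a) (by omega), Finset.prod_comm,
    Finset.prod_Ico_succ_top h, mul_comm]
  congr 1
  · refine Finset.prod_congr rfl fun i hi => ?_
    have := (Finset.mem_Ico.mp hi).2
    simp [show i ≤ b by omega]
  · rw [Finset.prod_comm (s := Finset.Ico a b) (t := Finset.Ico a b)]
    refine Finset.prod_congr rfl fun j hj => ?_
    rw [Finset.prod_Ico_succ_top h, if_neg, mul_one]
    have := (Finset.mem_Ico.mp hj).2
    omega

theorem blockPDF_self (t a : ℕ) (z : Fin d → ℝ) : blockPDF m S t a a z = 1 := by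
  simp [blockPDF]

/-- On at most `t + 1` coordinates each conditional density conditions on all remaining coordinates
of the window, so they multiply to the exact joint density. -/
theorem blockPDF_eq_windowPDF (hS : S.PosDef) {t : ℕ} (n : ℕ) {a b : ℕ} (hn : a + n = b)
    (h : b ≤ a + t + 1) (z : Fin d → ℝ) :
    blockPDF m S t a b z = windowPDF m S a b z := by
  induction n generalizing a with
  | zero =>
    obtain rfl : a = b := by omega
    rw [blockPDF_self, windowPDF_eq_one le_rfl]
  | succ n ih =>
    rw [blockPDF_succ_left hS t (by omega), ih (by omega) (by omega), min_eq_left (by omega),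
      div_mul_cancel₀ _ (windowPDF_pos hS _ _ z).ne']

theorem blockPDF_update {t a b : ℕ} {k : Fin d} (hk : (k : ℕ) < a ∨ b ≤ (k : ℕ)) (z : Fin d → ℝ)
    (x : ℝ) : blockPDF m S t a b (Function.update z k x) = blockPDF m S t a b z := by
  refine Finset.prod_congr rfl fun i hi => Finset.prod_congr rfl fun j hj => ?_
  rw [Finset.mem_Ico] at hi hj
  have h : ∀ p q, a ≤ p → q ≤ b →
      windowPDF m S p q (Function.update z k x) = windowPDF m S p q z := fun p q hp hq =>
    margPDF_update (by rw [mem_window]; omega) z x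
  unfold pairRatio
  rw [h i (j + 1) hi.1 (by omega), h (i + 1) j (by omega) hj.2.le, h i j hi.1 hj.2.le,
    h (i + 1) (j + 1) (by omega) (by omega)]

theorem lintegral_update_mul {ι : Type*} [DecidableEq ι] {k : ι} {f g : (ι → ℝ) → ℝ} {z : ι → ℝ}
    (hf : ∀ x, 0 ≤ f (Function.update z k x)) (hg : ∀ x, g (Function.update z k x) = g z)
    (h1 : ∫⁻ x, ENNReal.ofReal (f (Function.update z k x)) = 1) :
    ∫⁻ x, ENNReal.ofReal (f (Function.update z k x) * g (Function.update z k x)) =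
      ENNReal.ofReal (g z) := by
  simp only [hg, ENNReal.ofReal_mul (hf _)]
  rw [lintegral_mul_const' _ _ ENNReal.ofReal_ne_top, h1, one_mul]

/-- Once the coordinates before `a` are gone, coordinate `a` occurs only in its own conditional
density given its successors, which integrates to one. -/
theorem lmarginal_blockPDF_left (hS : S.PosDef) (t : ℕ) {a : ℕ} (ha : a ≤ d) (z : Fin d → ℝ) :
    lmarginal (fun _ => (volume : Measure ℝ)) (window d 0 a)
      (fun z => ENNReal.ofReal (blockPDF m S t 0 d z)) z =
      ENNReal.ofReal (blockPDF m S t a d z) := by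
  induction a generalizing z with
  | zero => rw [window_eq_empty le_rfl, lmarginal_empty]
  | succ a ih =>
    have hmin : a < min d (a + t + 1) := by omega
    rw [window_eq_insert_right (by omega) (by omega),
      lmarginal_insert _ (measurable_blockPDF t 0 d).ennreal_ofReal (by simp [mem_window])]
    simp only [ih (by omega), blockPDF_succ_left hS t (show a < d by omega)]
    refine lintegral_update_mul
      (f := fun z => windowPDF m S a (min d (a + t + 1)) z /
        windowPDF m S (a + 1) (min d (a + t + 1)) z)
      (fun x => (div_pos (windowPDF_pos hS _ _ _) (windowPDF_pos hS _ _ _)).le)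
      (fun x => blockPDF_update (by simp) z x) ?_
    unfold windowPDF
    rw [window_eq_insert_left (by omega) hmin]
    exact lintegral_margPDF_insert_div hS (by simp [mem_window]) z

theorem lmarginal_blockPDF_right (hS : S.PosDef) (t : ℕ) {a : ℕ} (n : ℕ) {b : ℕ}
    (hn : b + n = d) (hab : a ≤ b) (z : Fin d → ℝ) :
    lmarginal (fun _ => (volume : Measure ℝ)) (window d b d)
      (fun z => ENNReal.ofReal (blockPDF m S t a d z)) z =
      ENNReal.ofReal (blockPDF m S t a b z) := by
  induction n generalizing b z with
  | zero =>
    obtain rfl : b = d := by omega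
    rw [window_eq_empty le_rfl, lmarginal_empty]
  | succ n ih =>
    rw [window_eq_insert_left (by omega) (by omega),
      lmarginal_insert _ (measurable_blockPDF t a d).ennreal_ofReal (by simp [mem_window])]
    simp only [fun z => ih (b := b + 1) (by omega) (by omega) z, blockPDF_succ_right hS t hab]
    refine lintegral_update_mul
      (f := fun z => windowPDF m S (max a (b - t)) (b + 1) z /
        windowPDF m S (max a (b - t)) b z)
      (fun x => (div_pos (windowPDF_pos hS _ _ _) (windowPDF_pos hS _ _ _)).le)
      (fun x => blockPDF_update (by simp) z x) ?_
    unfold windowPDF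
    rw [window_eq_insert_right (by omega) (by omega)]
    exact lintegral_margPDF_insert_div hS (by simp [mem_window]) z

/-- The complement of a window consists of two end pieces, and the chain can be peeled from either
end. -/
theorem lmarginal_blockPDF (hS : S.PosDef) (t : ℕ) {a b : ℕ} (hab : a ≤ b) (hb : b ≤ d)
    (z : Fin d → ℝ) :
    lmarginal (fun _ => (volume : Measure ℝ)) (window d a b)ᶜ
      (fun z => ENNReal.ofReal (blockPDF m S t 0 d z)) z =
      ENNReal.ofReal (blockPDF m S t a b z) := by
  have h : (window d a b)ᶜ = window d b d ∪ window d 0 a := by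
    ext k; simp [mem_window]; omega
  have hd : Disjoint (window d b d) (window d 0 a) := by
    rw [Finset.disjoint_left]; intro k; simp only [mem_window]; omega
  rw [h, lmarginal_union _ _ (measurable_blockPDF t 0 d).ennreal_ofReal hd,
    funext fun z => lmarginal_blockPDF_left (m := m) hS t (hab.trans hb) z]
  exact lmarginal_blockPDF_right hS t (d - b) (by omega) hab z

end Window

/-! ### The Gaussian copula density in normal scores -/

section Copula

theorem strictMono_cdf_gaussianReal : StrictMono (cdf (gaussianReal 0 1)) := by
  intro x y hxy
  rw [cdf_eq_real, cdf_eq_real, ← Set.Iic_union_Ioc_eq_Iic hxy.le,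
    measureReal_union (Set.Iic_disjoint_Ioc le_rfl) measurableSet_Ioc, lt_add_iff_pos_right,
    measureReal_def, ENNReal.toReal_pos_iff]
  refine ⟨pos_iff_ne_zero.mpr fun h => ?_, measure_lt_top _ _⟩
  have := gaussianReal_absolutelyContinuous' 0 one_ne_zero h
  simp at this
  linarith

theorem stdNormalQuantile_cdf (x : ℝ) : stdNormalQuantile (cdf (gaussianReal 0 1) x) = x := by
  have : {y | cdf (gaussianReal 0 1) x ≤ cdf (gaussianReal 0 1) y} = Set.Ici x := by
    ext y; exact strictMono_cdf_gaussianReal.le_iff_le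
  rw [stdNormalQuantile, this, csInf_Ici]

/-- The Gaussian copula density in terms of normal scores. -/
def scoreCopulaPDF (ρ u v : ℝ) : ℝ :=
  stdBivariateNormalPDF ρ u v / (gaussianPDFReal 0 1 u * gaussianPDFReal 0 1 v)

theorem gaussianCopulaPDF_cdf (ρ u v : ℝ) :
    gaussianCopulaPDF ρ (cdf (gaussianReal 0 1) u) (cdf (gaussianReal 0 1) v) =
      scoreCopulaPDF ρ u v := by
  simp only [gaussianCopulaPDF, stdNormalQuantile_cdf, scoreCopulaPDF]

theorem one_sub_sq_pos {ρ : ℝ} (hρ : ρ ∈ Set.Ioo (-1 : ℝ) 1) : 0 < 1 - ρ ^ 2 := by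
  nlinarith [hρ.1, hρ.2]

theorem scoreCopulaPDF_eq {ρ : ℝ} (hρ : ρ ∈ Set.Ioo (-1 : ℝ) 1) (u v : ℝ) :
    scoreCopulaPDF ρ u v = (√(1 - ρ ^ 2))⁻¹ *
      Real.exp (-(ρ ^ 2 * (u ^ 2 + v ^ 2) - 2 * ρ * (u * v)) / (2 * (1 - ρ ^ 2))) := by
  have h := one_sub_sq_pos hρ
  have hs := Real.sqrt_pos.mpr h
  have hp : 0 < √(2 * Real.pi) := Real.sqrt_pos.mpr (by positivity)
  have e : Real.exp (-(u ^ 2 - 2 * ρ * u * v + v ^ 2) / (2 * (1 - ρ ^ 2))) =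
      Real.exp (-(ρ ^ 2 * (u ^ 2 + v ^ 2) - 2 * ρ * (u * v)) / (2 * (1 - ρ ^ 2))) *
        (Real.exp (-u ^ 2 / 2) * Real.exp (-v ^ 2 / 2)) := by
    rw [← Real.exp_add, ← Real.exp_add]
    congr 1
    field_simp
    ring
  unfold scoreCopulaPDF stdBivariateNormalPDF gaussianPDFReal
  simp only [NNReal.coe_one, mul_one, sub_zero]
  rw [e, div_eq_iff (by positivity)]
  have h2 : 2 * Real.pi = √(2 * Real.pi) * √(2 * Real.pi) :=
    (Real.mul_self_sqrt (by positivity)).symm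
  rw [mul_inv (2 * Real.pi)]
  conv_lhs => rw [h2]
  rw [mul_inv]
  ring

theorem scoreCopulaPDF_pos {ρ : ℝ} (hρ : ρ ∈ Set.Ioo (-1 : ℝ) 1) (u v : ℝ) :
    0 < scoreCopulaPDF ρ u v := by
  have := one_sub_sq_pos hρ
  rw [scoreCopulaPDF_eq hρ]; positivity

theorem scoreCopulaPDF_comm (ρ u v : ℝ) : scoreCopulaPDF ρ u v = scoreCopulaPDF ρ v u := by
  unfold scoreCopulaPDF stdBivariateNormalPDF
  rw [mul_comm (gaussianPDFReal 0 1 u)]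
  congr 4
  ring

theorem log_scoreCopulaPDF {ρ : ℝ} (hρ : ρ ∈ Set.Ioo (-1 : ℝ) 1) (u v : ℝ) :
    Real.log (scoreCopulaPDF ρ u v) = -Real.log (1 - ρ ^ 2) / 2 -
      (ρ ^ 2 * (u ^ 2 + v ^ 2) - 2 * ρ * (u * v)) / (2 * (1 - ρ ^ 2)) := by
  have h := one_sub_sq_pos hρ
  rw [scoreCopulaPDF_eq hρ, Real.log_mul (by positivity) (Real.exp_ne_zero _), Real.log_exp,
    Real.log_inv, Real.log_sqrt h.le]
  ring

/-- Density times copula density is the conditional density given the other score, and for a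
bivariate normal pair this is again normal. It serves both to identify joint densities and to show
that vine densities have mass one. -/
theorem gaussianPDFReal_mul_scoreCopulaPDF {ρ w : ℝ} (hρ : ρ ∈ Set.Ioo (-1 : ℝ) 1) (hw : 0 < w)
    (x v : ℝ) :
    gaussianPDFReal 0 w.toNNReal x * scoreCopulaPDF ρ (x / √w) v =
      gaussianPDFReal (√w * ρ * v) (w * (1 - ρ ^ 2)).toNNReal x := by
  have h := one_sub_sq_pos hρ
  -- With the variance written as a square, both exponents are rational functions of the variables.
  obtain ⟨r, hr, rfl⟩ : ∃ r, 0 < r ∧ w = r ^ 2 :=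
    ⟨√w, Real.sqrt_pos.mpr hw, (Real.sq_sqrt hw.le).symm⟩
  rw [scoreCopulaPDF_eq hρ, Real.sqrt_sq hr.le]
  unfold gaussianPDFReal
  rw [Real.coe_toNNReal _ hw.le, Real.coe_toNNReal _ (by positivity), mul_mul_mul_comm,
    ← mul_inv, ← Real.sqrt_mul (by positivity), ← Real.exp_add, mul_assoc (2 * Real.pi)]
  congr 2
  field_simp
  ring

end Copula

/-! ### Conditional distribution functions of densities with normal marginals -/

section ConditionalCDF

variable {d : ℕ} {m : Fin d → ℝ} {S : Matrix (Fin d) (Fin d) ℝ}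

/-- The standardised residual of the coordinate `j` given those in `D`. -/
def stdResid (m : Fin d → ℝ) (S : Matrix (Fin d) (Fin d) ℝ) (D : Finset (Fin d)) (j : Fin d)
    (z : Fin d → ℝ) : ℝ :=
  resid S D j (z - m) / √(residCov S D j j)

theorem gaussianReal_Iic (M x : ℝ) {w : ℝ} (hw : 0 < w) :
    gaussianReal M w.toNNReal (Set.Iic x) = gaussianReal 0 1 (Set.Iic ((x - M) / √w)) := by
  have hr := Real.sqrt_pos.mpr hw
  have h : (gaussianReal M w.toNNReal).map (fun x => (x - M) / √w) = gaussianReal 0 1 := by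
    have := Measure.map_map (μ := gaussianReal M w.toNNReal) (f := fun x => x - M)
      (g := fun x => x / √w) (by fun_prop) (by fun_prop)
    rw [show (fun x => (x - M) / √w) = (fun x => x / √w) ∘ fun x => x - M from rfl, ← this,
      gaussianReal_map_sub_const, gaussianReal_map_div_const, sub_self, zero_div]
    congr 1
    ext
    simp [Real.coe_toNNReal _ hw.le, Real.sq_sqrt hw.le, hw.ne']
  rw [← h, Measure.map_apply (by fun_prop) measurableSet_Iic]
  congr 1
  ext y
  simp [div_le_div_iff_of_pos_right hr]

theorem lmarginal_indicator_coord {s : Finset (Fin d)} {j : Fin d} (hj : j ∉ s)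
    (f : (Fin d → ℝ) → ℝ≥0∞) (c : ℝ) (z : Fin d → ℝ) :
    lmarginal (fun _ => (volume : Measure ℝ)) s ({w | w j ≤ c}.indicator f) z =
      {w | w j ≤ c}.indicator (lmarginal (fun _ => (volume : Measure ℝ)) s f) z := by
  unfold lmarginal
  have hu : ∀ y : (i : s) → ℝ, Function.updateFinset z s y j = z j := fun y => by
    simp [Function.updateFinset, hj]
  by_cases h : z j ≤ c
  · simp [Set.indicator, hu, h]
  · simp [Set.indicator, hu, h]

/-- Only the marginal of `f` on `insert j D` matters. Its conditional law of `j` given `D` is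
normal, and standardising turns the half-line probability into `Φ` of the standardised residual. -/
theorem conditionalCDF_eq (hS : S.PosDef) {f : (Fin d → ℝ) → ℝ≥0∞} (hf : Measurable f)
    {j : Fin d} {D : Finset (Fin d)} (hj : j ∉ D)
    (hmarg : ∀ z, lmarginal (fun _ => (volume : Measure ℝ)) (insert j D)ᶜ f z =
      ENNReal.ofReal (margPDF m S (insert j D) z)) (z : Fin d → ℝ) :
    conditionalCDF f j D z = cdf (gaussianReal 0 1) (stdResid m S D j z) := by
  have hrc := residCov_self_pos hS hj
  -- Coordinate `j` is to be integrated last, after `hmarg` has dealt with everything outside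
  -- `insert j D`.
  have hD : Dᶜ = insert j (insert j D)ᶜ := by
    ext k; by_cases hk : k = j <;> simp [hk, hj]
  have hjn : j ∉ (insert j D)ᶜ := by simp
  have hpos := margPDF_pos (m := m) (D := D) hS z
  have hden : lmarginal (fun _ => (volume : Measure ℝ)) Dᶜ f z =
      ENNReal.ofReal (margPDF m S D z) := by
    rw [hD, lmarginal_insert _ hf hjn]
    simp only [hmarg, margPDF_insert_update hS hj, ENNReal.ofReal_mul hpos.le]
    rw [lintegral_const_mul' _ _ ENNReal.ofReal_ne_top,
      lintegral_gaussianPDFReal_eq_one _ (by simpa using hrc), mul_one]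
  have hnum : lmarginal (fun _ => (volume : Measure ℝ)) Dᶜ ({w | w j ≤ z j}.indicator f) z =
      ENNReal.ofReal (margPDF m S D z) *
        gaussianReal (condMean m S D j z) (residCov S D j j).toNNReal (Set.Iic (z j)) := by
    rw [hD, lmarginal_insert _ (hf.indicator (measurableSet_le (by fun_prop) (by fun_prop))) hjn,
      gaussianReal_apply _ (by simpa using hrc), ← lintegral_indicator measurableSet_Iic,
      ← lintegral_const_mul' _ _ ENNReal.ofReal_ne_top]
    refine lintegral_congr fun x => ?_
    rw [lmarginal_indicator_coord hjn]
    by_cases hx : x ≤ z j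
    · rw [Set.indicator_of_mem (by simpa using hx), Set.indicator_of_mem (Set.mem_Iic.mpr hx),
        hmarg, margPDF_insert_update hS hj, ENNReal.ofReal_mul hpos.le, gaussianPDF]
    · simp [Set.indicator, hx]
  rw [conditionalCDF, hden, hnum, mul_comm, ENNReal.mul_div_cancel_right
    (by simpa using hpos) ENNReal.ofReal_ne_top, gaussianReal_Iic _ _ hrc, cdf_eq_real, stdResid,
    resid_eq_sub_condMean]
  rfl

end ConditionalCDF

/-! ### Pair ratios as copula densities with partial correlations -/

section PairRatio

variable {d : ℕ} {m : Fin d → ℝ} {S : Matrix (Fin d) (Fin d) ℝ}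

/-- The correlation of the residuals of the coordinates `i` and `j` given those in `D`. -/
def residCorr (S : Matrix (Fin d) (Fin d) ℝ) (D : Finset (Fin d)) (i j : Fin d) : ℝ :=
  residCov S D i j / √(residCov S D i i * residCov S D j j)

theorem residCorr_sq (hS : S.PosDef) {D : Finset (Fin d)} {i j : Fin d} (hi : i ∉ D)
    (hj : j ∉ D) : residCorr S D i j ^ 2 =
      residCov S D i j ^ 2 / (residCov S D i i * residCov S D j j) := by
  have := residCov_self_pos hS hi
  have := residCov_self_pos hS hj
  rw [residCorr, div_pow, Real.sq_sqrt (by positivity)]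

theorem residCov_insert_eq_residCorr (hS : S.PosDef) {D : Finset (Fin d)} {i j : Fin d}
    (hi : i ∉ D) (hj : j ∉ D) :
    residCov S (insert i D) j j = residCov S D j j * (1 - residCorr S D i j ^ 2) := by
  have := residCov_self_pos hS hi
  have := residCov_self_pos hS hj
  rw [residCov_insert_self hS hi, residCorr_sq hS hi hj]
  field_simp

theorem residCorr_mem (hS : S.PosDef) {D : Finset (Fin d)} {i j : Fin d} (hi : i ∉ D)
    (hj : j ∉ D) (hij : i ≠ j) : residCorr S D i j ∈ Set.Ioo (-1 : ℝ) 1 := by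
  have h1 : 0 < residCov S (insert i D) j j :=
    residCov_self_pos hS (by simp [hj, hij.symm])
  rw [residCov_insert_eq_residCorr hS hi hj] at h1
  have h2 := pos_of_mul_pos_right h1 (residCov_self_pos hS hj).le
  rw [Set.mem_Ioo, ← abs_lt, ← sq_lt_one_iff_abs_lt_one]
  linarith

/-- Sklar's decomposition conditionally on `D`: knowing `i` as well shifts the residual of `j` by a
multiple of the score of `i` and shrinks its variance by `1 - ρ ^ 2`, which is the effect of the
copula factor. -/
theorem margPDF_insert_insert (hS : S.PosDef) {D : Finset (Fin d)} {i j : Fin d} (hi : i ∉ D)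
    (hj : j ∉ D) (hij : i ≠ j) (z : Fin d → ℝ) :
    margPDF m S (insert j (insert i D)) z * margPDF m S D z =
      margPDF m S (insert i D) z * margPDF m S (insert j D) z *
        scoreCopulaPDF (residCorr S D i j) (stdResid m S D i z) (stdResid m S D j z) := by
  have hci := residCov_self_pos hS hi
  have hcj := residCov_self_pos hS hj
  have hr := residCorr_mem hS hi hj hij
  have hj' : j ∉ insert i D := by simp [hj, hij.symm]
  have e : resid S (insert i D) j (z - m) = resid S D j (z - m) -
      √(residCov S D j j) * residCorr S D i j * stdResid m S D i z := by
    rw [resid_insert hS hi, residCorr, stdResid, Real.sqrt_mul hci.le]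
    have hsi := Real.sqrt_pos.mpr hci
    have hsj := Real.sqrt_pos.mpr hcj
    congr 1
    rw [← Real.mul_self_sqrt hci.le]
    simp only [Real.sqrt_mul_self hsi.le]
    field_simp
  rw [margPDF_insert hS hj', residCov_insert_eq_residCorr hS hi hj, e, gaussianPDFReal_sub,
    zero_add, ← gaussianPDFReal_mul_scoreCopulaPDF hr hcj, margPDF_insert hS hj, scoreCopulaPDF_comm]
  simp only [stdResid]
  ring

theorem Ioo_eq_window (i j : Fin d) : Finset.Ioo i j = window d (i + 1) j := by
  ext k; rw [Finset.mem_Ioo, mem_window, Fin.lt_def, Fin.lt_def]; omega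

theorem insert_Ioo_left {i j : Fin d} (hij : i < j) :
    insert i (Finset.Ioo i j) = window d i j := by
  rw [Ioo_eq_window, window_eq_insert_left i.2 hij]

theorem insert_Ioo_right {i j : Fin d} (hij : i < j) :
    insert j (Finset.Ioo i j) = window d (i + 1) (j + 1) := by
  rw [Ioo_eq_window, window_eq_insert_right j.2 hij]

theorem pairRatio_eq_scoreCopulaPDF (hS : S.PosDef) {i j : Fin d} (hij : i < j) (z : Fin d → ℝ) :
    pairRatio m S i j z = scoreCopulaPDF (residCorr S (Finset.Ioo i j) i j)
      (stdResid m S (Finset.Ioo i j) i z) (stdResid m S (Finset.Ioo i j) j z) := by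
  have h := margPDF_insert_insert (m := m) (D := Finset.Ioo i j) hS (by simp) (by simp) hij.ne z
  have hw : insert j (insert i (Finset.Ioo i j)) = window d i (j + 1) := by
    rw [insert_Ioo_left hij, window_eq_insert_right j.2 hij.le]
  rw [hw, insert_Ioo_left hij, insert_Ioo_right hij] at h
  have h1 := windowPDF_pos (m := m) hS i j z
  have h2 := windowPDF_pos (m := m) hS (i + 1) (j + 1) z
  rw [pairRatio, div_eq_iff (by positivity), mul_comm (scoreCopulaPDF _ _ _)]
  unfold windowPDF
  rw [← h, ← Ioo_eq_window]

/-- For an edge of tree `t + 1`, the coordinates `[i, j)` number exactly `t + 1`, the longest window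
on which the chain of order `t` is guaranteed to have the true law. -/
theorem conditionalCDF_blockPDF_left (hS : S.PosDef) {t : ℕ} {i j : Fin d}
    (hij : (i : ℕ) + (t + 1) = j) (z : Fin d → ℝ) :
    conditionalCDF (fun z => ENNReal.ofReal (blockPDF m S t 0 d z)) i (Finset.Ioo i j) z =
      cdf (gaussianReal 0 1) (stdResid m S (Finset.Ioo i j) i z) := by
  have hlt : i < j := by rw [Fin.lt_def]; omega
  refine conditionalCDF_eq hS (measurable_blockPDF t 0 d).ennreal_ofReal (by simp) (fun z => ?_) z
  rw [insert_Ioo_left hlt, lmarginal_blockPDF hS t hlt.le j.2.le,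
    blockPDF_eq_windowPDF hS (t + 1) hij (by omega)]
  rfl

theorem conditionalCDF_blockPDF_right (hS : S.PosDef) {t : ℕ} {i j : Fin d}
    (hij : (i : ℕ) + (t + 1) = j) (z : Fin d → ℝ) :
    conditionalCDF (fun z => ENNReal.ofReal (blockPDF m S t 0 d z)) j (Finset.Ioo i j) z =
      cdf (gaussianReal 0 1) (stdResid m S (Finset.Ioo i j) j z) := by
  have hlt : i < j := by rw [Fin.lt_def]; omega
  refine conditionalCDF_eq hS (measurable_blockPDF t 0 d).ennreal_ofReal (by simp) (fun z => ?_) z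
  rw [insert_Ioo_right hlt, lmarginal_blockPDF hS t (by omega) (by omega),
    blockPDF_eq_windowPDF hS (t + 1) (by omega) (by omega)]
  rfl

end PairRatio

/-! ### Truncated vine densities and their total mass -/

section Vine

variable {d : ℕ} {S : Matrix (Fin d) (Fin d) ℝ}

/-- The copula factor with parameter `ρ` of the edge `e` of the vine. -/
def edgeCopula (m : Fin d → ℝ) (S : Matrix (Fin d) (Fin d) ℝ) (ρ : ℝ) (e : Fin d × Fin d)
    (z : Fin d → ℝ) : ℝ :=
  scoreCopulaPDF ρ (stdResid m S (Finset.Ioo e.1 e.2) e.1 z)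
    (stdResid m S (Finset.Ioo e.1 e.2) e.2 z)

theorem mem_treeEdges {t : ℕ} {e : Fin d × Fin d} :
    e ∈ treeEdges d t ↔ (e.1 : ℕ) + t = (e.2 : ℕ) := by
  simp [treeEdges]

theorem lt_of_mem_treeEdges {t : ℕ} {e : Fin d × Fin d} (he : e ∈ treeEdges d (t + 1)) :
    e.1 < e.2 := by
  rw [mem_treeEdges] at he
  rw [Fin.lt_def]; omega

theorem measurable_edgeCopula (m : Fin d → ℝ) (ρ : ℝ) (e : Fin d × Fin d) :
    Measurable (edgeCopula m S ρ e) := by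
  have h (j : Fin d) : Measurable fun z => stdResid m S (Finset.Ioo e.1 e.2) j z := by
    have : Measurable fun z : Fin d → ℝ => resid S (Finset.Ioo e.1 e.2) j (z - m) :=
      (measurable_resid j).comp (measurable_id.sub_const m)
    exact this.div_const _
  have h1 := h e.1
  have h2 := h e.2
  unfold edgeCopula scoreCopulaPDF stdBivariateNormalPDF
  fun_prop

theorem edgeCopula_pos (m : Fin d → ℝ) {η : Fin d → Fin d → ℝ} (hη : Admissible η) {t : ℕ}
    {e : Fin d × Fin d} (he : e ∈ treeEdges d (t + 1)) (z : Fin d → ℝ) :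
    0 < edgeCopula m S (η e.1 e.2) e z :=
  scoreCopulaPDF_pos (hη _ _ (lt_of_mem_treeEdges he)) _ _

theorem blockPDF_succ (m : Fin d → ℝ) (t : ℕ) (z : Fin d → ℝ) :
    blockPDF m S (t + 1) 0 d z =
      blockPDF m S t 0 d z * ∏ e ∈ treeEdges d (t + 1), pairRatio m S e.1 e.2 z := by
  have h : ∏ e ∈ treeEdges d (t + 1), pairRatio m S e.1 e.2 z = ∏ i ∈ Finset.Ico 0 d,
      ∏ j ∈ Finset.Ico 0 d, if i + (t + 1) = j then pairRatio m S i j z else 1 := by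
    rw [treeEdges, Finset.prod_filter, Fintype.prod_prod_type]
    simp only [← Finset.range_eq_Ico]
    rw [← Fin.prod_univ_eq_prod_range (fun i => ∏ j ∈ Finset.range d,
      if i + (t + 1) = j then pairRatio m S i j z else 1) d]
    refine Finset.prod_congr rfl fun i _ => ?_
    rw [← Fin.prod_univ_eq_prod_range]
  rw [h]
  unfold blockPDF
  simp only [← Finset.prod_mul_distrib]
  refine Finset.prod_congr rfl fun i _ => Finset.prod_congr rfl fun j _ => ?_
  by_cases h1 : i + (t + 1) = j
  · rw [if_pos (by omega), if_neg (by omega), if_pos h1, one_mul]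
  · rw [if_neg h1, mul_one]
    congr 1
    simp only [eq_iff_iff]; omega

/-- The copula arguments in tree `t + 1` come from the level `t` density alone, so the new
parameters remain free. This is what makes each minimisation split over the edges. -/
theorem vineDensity_succ (hS : S.PosDef) {ν : EuclideanSpace ℝ (Fin d)} {s : Fin d → ℝ}
    {η : Fin d → Fin d → ℝ} (hη : Admissible η) {t : ℕ} {m : Fin d → ℝ}
    (h : vineDensity ν s η t = fun z => ENNReal.ofReal (blockPDF m S t 0 d z)) :
    vineDensity ν s η (t + 1) = fun z => ENNReal.ofReal (blockPDF m S t 0 d z *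
      ∏ e ∈ treeEdges d (t + 1), edgeCopula m S (η e.1 e.2) e z) := by
  funext z
  rw [vineDensity, h, ENNReal.ofReal_mul (blockPDF_pos hS _ _ _ _).le,
    ENNReal.ofReal_prod_of_nonneg fun e he => (edgeCopula_pos m hη he z).le]
  beta_reduce
  congr 1
  refine Finset.prod_congr rfl fun e he => ?_
  rw [conditionalCDF_blockPDF_left hS (mem_treeEdges.mp he),
    conditionalCDF_blockPDF_right hS (mem_treeEdges.mp he), gaussianCopulaPDF_cdf]
  rfl

theorem blockPDF_zero (hS : S.PosDef) (m : Fin d → ℝ) (z : Fin d → ℝ) :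
    blockPDF m S 0 0 d z = ∏ j : Fin d, gaussianPDFReal (m j) (S j j).toNNReal (z j) := by
  have h : ∀ j : Fin d, pairRatio m S j j z = gaussianPDFReal (m j) (S j j).toNNReal (z j) := by
    intro j
    rw [pairRatio, windowPDF_eq_one (Nat.le_succ _), windowPDF_eq_one le_rfl,
      windowPDF_eq_one le_rfl, mul_one, mul_one, div_one, windowPDF,
      window_eq_insert_right j.2 le_rfl, window_eq_empty le_rfl, margPDF_insert hS (by simp),
      margPDF_empty, one_mul, residCov_empty, resid_empty, Pi.sub_apply, gaussianPDFReal_sub,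
      zero_add]
  simp only [← h]
  rw [Fin.prod_univ_eq_prod_range (fun j => pairRatio m S j j z), blockPDF, Finset.range_eq_Ico]
  refine Finset.prod_congr rfl fun i hi => ?_
  rw [Finset.prod_eq_single_of_mem i hi]
  · simp
  · intro j _ hj
    rw [if_neg]; omega

theorem vineDensity_zero (ν : EuclideanSpace ℝ (Fin d)) (s : Fin d → ℝ)
    (η : Fin d → Fin d → ℝ) : vineDensity ν s η 0 = fun z => ENNReal.ofReal
      (∏ j, gaussianPDFReal (ν j) (s j ^ 2).toNNReal (z j)) := by
  funext z
  rw [vineDensity, ENNReal.ofReal_prod_of_nonneg fun _ _ => gaussianPDFReal_nonneg _ _ _]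
  refine Finset.prod_congr rfl fun j _ => ?_
  have : (⟨s j ^ 2, sq_nonneg (s j)⟩ : ℝ≥0) = (s j ^ 2).toNNReal :=
    (Real.toNNReal_of_nonneg (sq_nonneg (s j))).symm
  rw [this]
  rfl

theorem vineDensity_eq_blockPDF (hS : S.PosDef) {ν : EuclideanSpace ℝ (Fin d)} {s : Fin d → ℝ}
    {η : Fin d → Fin d → ℝ} (hη : Admissible η) (hs : ∀ j, s j = √(S j j)) {t : ℕ}
    (h : ∀ i j : Fin d, i < j → (j : ℕ) ≤ i + t → η i j = residCorr S (Finset.Ioo i j) i j) :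
    vineDensity ν s η t = fun z => ENNReal.ofReal (blockPDF (fun j => ν j) S t 0 d z) := by
  induction t with
  | zero =>
    rw [vineDensity_zero]
    funext z
    rw [blockPDF_zero hS]
    simp only [hs, Real.sq_sqrt hS.diag_pos.le]
  | succ t ih =>
    rw [vineDensity_succ hS hη (ih fun i j hij hj => h i j hij (by omega))]
    funext z
    rw [blockPDF_succ]
    congr 2
    refine Finset.prod_congr rfl fun e he => ?_
    have hlt := lt_of_mem_treeEdges he
    rw [pairRatio_eq_scoreCopulaPDF hS hlt, edgeCopula,
      h e.1 e.2 hlt (by rw [mem_treeEdges] at he; omega)]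

/-- For any admissible `ρ`, the conditional density of `i` given the coordinates in between, times
the edge copula, is a normal density in coordinate `i`; the score of `j` only moves its mean. -/
theorem lintegral_windowPDF_mul_edgeCopula (hS : S.PosDef) (m : Fin d → ℝ) {ρ : ℝ}
    (hρ : ρ ∈ Set.Ioo (-1 : ℝ) 1) {i j : Fin d} (hij : i < j) (z : Fin d → ℝ) :
    ∫⁻ x, ENNReal.ofReal (windowPDF m S i j (Function.update z i x) /
      windowPDF m S (i + 1) j (Function.update z i x) *
        edgeCopula m S ρ (i, j) (Function.update z i x)) = 1 := by
  set D := Finset.Ioo i j with hD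
  have hi : i ∉ D := by simp [hD]
  have hc := residCov_self_pos hS hi
  have h1 := one_sub_sq_pos hρ
  have hv (x : ℝ) : stdResid m S D j (Function.update z i x) = stdResid m S D j z := by
    unfold stdResid
    rw [resid_congr (y' := z - m)]
    · simp [hij.ne']
    · intro k hk
      rw [Pi.sub_apply, Function.update_of_ne]; rfl
      rintro rfl; exact hi hk
  have key (x : ℝ) : windowPDF m S i j (Function.update z i x) /
      windowPDF m S (i + 1) j (Function.update z i x) *
        edgeCopula m S ρ (i, j) (Function.update z i x) =
      gaussianPDFReal (√(residCov S D i i) * ρ * stdResid m S D j z + condMean m S D i z)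
        (residCov S D i i * (1 - ρ ^ 2)).toNNReal x := by
    rw [windowPDF, windowPDF, ← insert_Ioo_left hij, ← Ioo_eq_window, margPDF_insert hS hi,
      mul_div_cancel_left₀ _ (margPDF_pos hS _).ne', edgeCopula, hv, ← gaussianPDFReal_sub,
      ← gaussianPDFReal_mul_scoreCopulaPDF hρ hc, ← resid_update hi]
    rfl
  simp only [key]
  refine lintegral_gaussianPDFReal_eq_one _ ?_
  simp only [ne_eq, Real.toNNReal_eq_zero, not_le]
  positivity

/-- The edges of tree `t` whose first coordinate is at least `a`. -/
def tailEdges (d t a : ℕ) : Finset (Fin d × Fin d) :=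
  (treeEdges d t).filter fun e => a ≤ (e.1 : ℕ)

/-- Integrating from the left, coordinate `a` meets at most one remaining edge, the one to `a + t +
1`. The case `a = d` gives total mass one whatever the parameters of the last tree. -/
theorem lmarginal_blockPDF_mul_edgeCopula (hS : S.PosDef) (m : Fin d → ℝ)
    {η : Fin d → Fin d → ℝ} (hη : Admissible η) (t : ℕ) {a : ℕ} (ha : a ≤ d) (z : Fin d → ℝ) :
    lmarginal (fun _ => (volume : Measure ℝ)) (window d 0 a)
      (fun z => ENNReal.ofReal (blockPDF m S t 0 d z *
        ∏ e ∈ treeEdges d (t + 1), edgeCopula m S (η e.1 e.2) e z)) z =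
      ENNReal.ofReal (blockPDF m S t a d z *
        ∏ e ∈ tailEdges d (t + 1) a, edgeCopula m S (η e.1 e.2) e z) := by
  induction a generalizing z with
  | zero =>
    rw [window_eq_empty le_rfl, lmarginal_empty, tailEdges, Finset.filter_true_of_mem (by simp)]
  | succ a ih =>
    have hmin : a < min d (a + t + 1) := by omega
    have hmeas : Measurable fun z => ENNReal.ofReal (blockPDF m S t 0 d z *
        ∏ e ∈ treeEdges d (t + 1), edgeCopula m S (η e.1 e.2) e z) :=
      ((measurable_blockPDF t 0 d).mul (Finset.measurable_prod _ fun e _ =>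
        measurable_edgeCopula m _ e)).ennreal_ofReal
    -- The edges still present start beyond `a`, so their residuals do not see coordinate `a`.
    have hg : ∀ x, blockPDF m S t (a + 1) d (Function.update z ⟨a, ha⟩ x) *
        ∏ e ∈ tailEdges d (t + 1) (a + 1),
          edgeCopula m S (η e.1 e.2) e (Function.update z ⟨a, ha⟩ x) =
        blockPDF m S t (a + 1) d z * ∏ e ∈ tailEdges d (t + 1) (a + 1),
          edgeCopula m S (η e.1 e.2) e z := by
      intro x
      rw [blockPDF_update (by simp)]
      congr 1
      refine Finset.prod_congr rfl fun e he => ?_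
      simp only [tailEdges, Finset.mem_filter] at he
      have hlt := lt_of_mem_treeEdges he.1
      have hz : ∀ k : Fin d, e.1 ≤ k → (Function.update z ⟨a, ha⟩ x - m) k = (z - m) k := by
        intro k hk
        rw [Pi.sub_apply, Function.update_of_ne]; rfl
        rw [Fin.le_def] at hk
        intro h
        rw [h] at hk
        simp only at hk
        omega
      unfold edgeCopula stdResid
      rw [resid_congr (hz e.1 le_rfl) fun k hk => hz k (Finset.mem_Ioo.mp hk).1.le,
        resid_congr (hz e.2 hlt.le) fun k hk => hz k (Finset.mem_Ioo.mp hk).1.le]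
    rw [window_eq_insert_right (by omega) (by omega),
      lmarginal_insert _ hmeas (by simp [mem_window])]
    simp only [ih (by omega), blockPDF_succ_left hS t (show a < d by omega)]
    -- Near the right end `a` starts no edge of this tree, and the plain conditional density is all
    -- there is to integrate.
    by_cases hedge : a + t + 1 < d
    · have hins : tailEdges d (t + 1) a =
          insert (⟨a, ha⟩, ⟨a + t + 1, hedge⟩) (tailEdges d (t + 1) (a + 1)) := by
        ext ⟨i, j⟩
        simp only [tailEdges, Finset.mem_filter, mem_treeEdges, Finset.mem_insert, Prod.mk.injEq,
          Fin.ext_iff]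
        omega
      simp only [hins]
      simp only [Finset.prod_insert (show ((⟨a, ha⟩, ⟨a + t + 1, hedge⟩) : Fin d × Fin d) ∉
        tailEdges d (t + 1) (a + 1) by simp [tailEdges]), min_eq_right hedge.le]
      refine (lintegral_congr fun x => by rw [mul_mul_mul_comm]).trans (lintegral_update_mul
        (f := fun z => windowPDF m S a (a + t + 1) z / windowPDF m S (a + 1) (a + t + 1) z *
          edgeCopula m S (η ⟨a, ha⟩ ⟨a + t + 1, hedge⟩) (⟨a, ha⟩, ⟨a + t + 1, hedge⟩) z)
        (g := fun z => blockPDF m S t (a + 1) d z *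
          ∏ e ∈ tailEdges d (t + 1) (a + 1), edgeCopula m S (η e.1 e.2) e z)
        (fun x => ?_) hg ?_)
      · exact (mul_pos (div_pos (windowPDF_pos hS _ _ _) (windowPDF_pos hS _ _ _))
          (scoreCopulaPDF_pos (hη _ _ (by simp [Fin.lt_def])) _ _)).le
      · exact lintegral_windowPDF_mul_edgeCopula hS m (hη _ _ (by simp [Fin.lt_def]))
          (i := ⟨a, ha⟩) (j := ⟨a + t + 1, hedge⟩) (by simp [Fin.lt_def]) z
    · have hins : tailEdges d (t + 1) a = tailEdges d (t + 1) (a + 1) := by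
        ext ⟨i, j⟩
        simp only [tailEdges, Finset.mem_filter, mem_treeEdges]
        have := j.2
        omega
      simp only [hins, mul_assoc]
      refine lintegral_update_mul
        (f := fun z => windowPDF m S a (min d (a + t + 1)) z /
          windowPDF m S (a + 1) (min d (a + t + 1)) z)
        (g := fun z => blockPDF m S t (a + 1) d z *
          ∏ e ∈ tailEdges d (t + 1) (a + 1), edgeCopula m S (η e.1 e.2) e z)
        (fun x => (div_pos (windowPDF_pos hS _ _ _) (windowPDF_pos hS _ _ _)).le) hg ?_
      unfold windowPDF
      rw [window_eq_insert_left (by omega) hmin]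
      exact lintegral_margPDF_insert_div hS (by simp [mem_window]) z

theorem lintegral_blockPDF_mul_edgeCopula (hS : S.PosDef) (m : Fin d → ℝ)
    {η : Fin d → Fin d → ℝ} (hη : Admissible η) (t : ℕ) :
    ∫⁻ z, ENNReal.ofReal (blockPDF m S t 0 d z *
      ∏ e ∈ treeEdges d (t + 1), edgeCopula m S (η e.1 e.2) e z) = 1 := by
  have h := lmarginal_blockPDF_mul_edgeCopula hS m hη t le_rfl 0
  have h0 : tailEdges d (t + 1) d = ∅ := by
    ext ⟨i, j⟩; simp [tailEdges]
  rw [window_zero, ← lintegral_eq_lmarginal_univ, blockPDF_self, h0] at h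
  simpa [volume_pi] using h

end Vine

/-! ### Partial correlations under passage to the correlation matrix -/

section Correlation

variable {d : ℕ} {S : Matrix (Fin d) (Fin d) ℝ}

theorem sqrt_diag_pos (hS : S.PosDef) (j : Fin d) : 0 < √(S j j) :=
  Real.sqrt_pos.mpr hS.diag_pos

theorem posDef_corrMatrix (hS : S.PosDef) : (corrMatrix S).PosDef := by
  have h : corrMatrix S = (Matrix.diagonal fun i => (√(S i i))⁻¹).conjTranspose * S *
      Matrix.diagonal fun i => (√(S i i))⁻¹ := by
    ext i j
    simp [corrMatrix, Matrix.diagonal_mul, Matrix.mul_diagonal]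
    field_simp
  rw [h]
  refine hS.conjTranspose_mul_mul_same fun x y hxy => ?_
  ext i
  have := congrFun hxy i
  simpa [Matrix.mulVec_diagonal, (sqrt_diag_pos hS i).ne'] using this

/-- Rescaling the coordinates rescales the regression coefficients by quotients of standard
deviations; the rescaled vector is identified by `subSolve_unique`. -/
theorem residCov_corrMatrix (hS : S.PosDef) (D : Finset (Fin d)) (i j : Fin d) :
    residCov (corrMatrix S) D i j = residCov S D i j / (√(S i i) * √(S j j)) := by
  have hsol : subSolve (corrMatrix S) D (fun k => corrMatrix S k j) =
      fun k => √(S k k) / √(S j j) * subSolve S D (fun k => S k j) k := by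
    refine subSolve_unique (posDef_corrMatrix hS)
      (fun k hk => by rw [subSolve_of_notMem hk, mul_zero]) fun k hk => ?_
    simp only [corrMatrix, Matrix.of_apply]
    rw [← mulVec_subSolve hS hk (fun k => S k j), Finset.sum_div]
    refine Finset.sum_congr rfl fun l _ => ?_
    have := sqrt_diag_pos hS l
    field_simp
  rw [residCov_eq, residCov_eq, hsol, sub_div, Finset.sum_div]
  congr 1
  refine Finset.sum_congr rfl fun l _ => ?_
  simp only [corrMatrix, Matrix.of_apply]
  have := sqrt_diag_pos hS l
  field_simp

theorem partialCorr_corrMatrix (hS : S.PosDef) (D : Finset (Fin d)) (i j : Fin d) :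
    partialCorr (corrMatrix S) D i j = residCorr S D i j := by
  have hi := sqrt_diag_pos hS i
  have hj := sqrt_diag_pos hS j
  simp only [partialCorr, partialCov_eq_residCov, residCov_corrMatrix hS, residCorr]
  rw [show residCov S D i i / (√(S i i) * √(S i i)) * (residCov S D j j / (√(S j j) * √(S j j))) =
    residCov S D i i * residCov S D j j / (√(S i i) * √(S j j)) ^ 2 by field_simp,
    Real.sqrt_div' _ (by positivity), Real.sqrt_sq (by positivity),
    div_div_div_cancel_right₀ (by positivity)]

end Correlation

/-! ### Comparing divergences through expected log densities -/

section KullbackLeibler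

variable {α : Type*} [MeasurableSpace α]

/-- Equal total masses remove the mass correction in `klDiv`. Integrability of both logarithms makes
the divergence finite, so comparing two candidates may drop the common entropy term. -/
theorem klDiv_withDensity_ofReal {lam : Measure α} [SigmaFinite lam] {f g : α → ℝ}
    (hf : Measurable f) (hg : Measurable g) (hf0 : ∀ x, 0 < f x) (hg0 : ∀ x, 0 < g x)
    (hf1 : ∫⁻ x, ENNReal.ofReal (f x) ∂lam = 1) (hg1 : ∫⁻ x, ENNReal.ofReal (g x) ∂lam = 1)
    (hfi : Integrable (fun x => Real.log (f x)) (lam.withDensity fun x => ENNReal.ofReal (f x)))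
    (hgi : Integrable (fun x => Real.log (g x)) (lam.withDensity fun x => ENNReal.ofReal (f x))) :
    klDiv (lam.withDensity fun x => ENNReal.ofReal (f x))
        (lam.withDensity fun x => ENNReal.ofReal (g x)) ≠ ∞ ∧
      (klDiv (lam.withDensity fun x => ENNReal.ofReal (f x))
        (lam.withDensity fun x => ENNReal.ofReal (g x))).toReal =
      ∫ x, Real.log (f x) ∂(lam.withDensity fun x => ENNReal.ofReal (f x)) -
        ∫ x, Real.log (g x) ∂(lam.withDensity fun x => ENNReal.ofReal (f x)) := by
  set p := lam.withDensity fun x => ENNReal.ofReal (f x) with hp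
  set q := lam.withDensity fun x => ENNReal.ofReal (g x) with hq
  have hpu : p Set.univ = 1 := by rw [hp, withDensity_apply _ .univ, Measure.restrict_univ, hf1]
  have hqu : q Set.univ = 1 := by rw [hq, withDensity_apply _ .univ, Measure.restrict_univ, hg1]
  have : IsFiniteMeasure p := ⟨by rw [hpu]; exact ENNReal.one_lt_top⟩
  have : IsFiniteMeasure q := ⟨by rw [hqu]; exact ENNReal.one_lt_top⟩
  have hh : Measurable fun x => ENNReal.ofReal (f x / g x) := (hf.div hg).ennreal_ofReal
  have hpq : p = q.withDensity fun x => ENNReal.ofReal (f x / g x) := by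
    rw [hp, hq, ← withDensity_mul _ hg.ennreal_ofReal hh]
    congr 1
    funext x
    rw [Pi.mul_apply, ← ENNReal.ofReal_mul (hg0 x).le, mul_div_cancel₀ _ (hg0 x).ne']
  have hac : p ≪ q := hpq ▸ withDensity_absolutelyContinuous _ _
  have hllr : llr p q =ᵐ[p] fun x => Real.log (f x) - Real.log (g x) := by
    have h1 : p.rnDeriv q =ᵐ[q] fun x => ENNReal.ofReal (f x / g x) := by
      conv_lhs => rw [hpq]
      exact Measure.rnDeriv_withDensity _ hh
    filter_upwards [hac.ae_eq h1] with x hx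
    rw [llr, hx, ENNReal.toReal_ofReal (div_pos (hf0 x) (hg0 x)).le,
      Real.log_div (hf0 x).ne' (hg0 x).ne']
  have hint : Integrable (llr p q) p := (integrable_congr hllr).mpr (hfi.sub hgi)
  refine ⟨klDiv_ne_top hac hint, ?_⟩
  rw [toReal_klDiv_of_measure_eq hac (hpu.trans hqu.symm), integral_congr_ae hllr,
    integral_sub hfi hgi]

theorem klDiv_withDensity_le_iff {lam : Measure α} [SigmaFinite lam] {f g g' : α → ℝ}
    (hf : Measurable f) (hg : Measurable g) (hg' : Measurable g')
    (hf0 : ∀ x, 0 < f x) (hg0 : ∀ x, 0 < g x) (hg0' : ∀ x, 0 < g' x)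
    (hf1 : ∫⁻ x, ENNReal.ofReal (f x) ∂lam = 1) (hg1 : ∫⁻ x, ENNReal.ofReal (g x) ∂lam = 1)
    (hg1' : ∫⁻ x, ENNReal.ofReal (g' x) ∂lam = 1)
    (hfi : Integrable (fun x => Real.log (f x)) (lam.withDensity fun x => ENNReal.ofReal (f x)))
    (hgi : Integrable (fun x => Real.log (g x)) (lam.withDensity fun x => ENNReal.ofReal (f x)))
    (hgi' : Integrable (fun x => Real.log (g' x))
      (lam.withDensity fun x => ENNReal.ofReal (f x))) :
    klDiv (lam.withDensity fun x => ENNReal.ofReal (f x))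
        (lam.withDensity fun x => ENNReal.ofReal (g x)) ≤
      klDiv (lam.withDensity fun x => ENNReal.ofReal (f x))
        (lam.withDensity fun x => ENNReal.ofReal (g' x)) ↔
      ∫ x, Real.log (g' x) ∂(lam.withDensity fun x => ENNReal.ofReal (f x)) ≤
        ∫ x, Real.log (g x) ∂(lam.withDensity fun x => ENNReal.ofReal (f x)) := by
  obtain ⟨h1, h2⟩ := klDiv_withDensity_ofReal hf hg hf0 hg0 hf1 hg1 hfi hgi
  obtain ⟨h1', h2'⟩ := klDiv_withDensity_ofReal hf hg' hf0 hg0' hf1 hg1' hfi hgi'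
  rw [← ENNReal.toReal_le_toReal h1 h1', h2, h2', sub_le_sub_iff_left]

end KullbackLeibler

/-! ### Expected log densities under the normal posterior -/

section Moments

variable {d : ℕ} {S : Matrix (Fin d) (Fin d) ℝ} {μ : EuclideanSpace ℝ (Fin d)}

theorem memLp_coord (k : Fin d) :
    MemLp (fun z : EuclideanSpace ℝ (Fin d) => z k) 2 (multivariateGaussian μ S) :=
  (EuclideanSpace.proj (𝕜 := ℝ) k).comp_memLp' IsGaussian.memLp_two_id

theorem memLp_centered (k : Fin d) :
    MemLp (fun z : EuclideanSpace ℝ (Fin d) => z k - μ k) 2 (multivariateGaussian μ S) :=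
  (memLp_coord k).sub (memLp_const _)

theorem integral_coord (k : Fin d) :
    ∫ z : EuclideanSpace ℝ (Fin d), z k ∂(multivariateGaussian μ S) = μ k := by
  have := (EuclideanSpace.proj (𝕜 := ℝ) k).integral_comp_comm
    (IsGaussian.integrable_id (μ := multivariateGaussian μ S))
  simpa using this

theorem integral_centered_mul_centered (hS : S.PosDef) (k l : Fin d) :
    ∫ z : EuclideanSpace ℝ (Fin d), (z k - μ k) * (z l - μ l) ∂(multivariateGaussian μ S) =
      S k l := by
  have := covariance_eval_multivariateGaussian (μ := μ) hS.posSemidef k l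
  rwa [covariance, integral_coord, integral_coord] at this

theorem memLp_resid (D : Finset (Fin d)) (j : Fin d) :
    MemLp (fun z : EuclideanSpace ℝ (Fin d) => resid S D j ((fun k => z k) - fun k => μ k)) 2
      (multivariateGaussian μ S) := by
  simp only [resid_eq_sum, Pi.sub_apply]
  exact memLp_finsetSum _ fun k _ => (memLp_centered k).const_mul _

theorem integral_resid_mul_resid (hS : S.PosDef) (D : Finset (Fin d)) (i j : Fin d) :
    ∫ z : EuclideanSpace ℝ (Fin d), resid S D i ((fun k => z k) - fun k => μ k) *
      resid S D j ((fun k => z k) - fun k => μ k) ∂(multivariateGaussian μ S) =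
      residCov S D i j := by
  simp only [resid_eq_sum, Pi.sub_apply, Finset.sum_mul_sum]
  have hi (k l : Fin d) : Integrable (fun z : EuclideanSpace ℝ (Fin d) =>
      residVec S D i k * (z k - μ k) * (residVec S D j l * (z l - μ l)))
      (multivariateGaussian μ S) :=
    ((memLp_centered k).const_mul _).integrable_mul ((memLp_centered l).const_mul _)
  rw [integral_finsetSum _ fun k _ => integrable_finsetSum _ fun l _ => hi k l,
    ← sum_residVec_mul_residVec hS]
  refine Finset.sum_congr rfl fun k _ => ?_
  rw [integral_finsetSum _ fun l _ => hi k l]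
  refine Finset.sum_congr rfl fun l _ => ?_
  rw [← integral_centered_mul_centered (μ := μ) hS k l, ← integral_const_mul, ← integral_mul_const]
  refine integral_congr_ae (.of_forall fun z => ?_)
  ring

theorem log_gaussianPDFReal (M : ℝ) {w : ℝ} (hw : 0 < w) (x : ℝ) :
    Real.log (gaussianPDFReal M w.toNNReal x) =
      -Real.log (2 * Real.pi * w) / 2 - (x - M) ^ 2 / (2 * w) := by
  rw [gaussianPDFReal, Real.coe_toNNReal _ hw.le, Real.log_mul (by positivity)
    (Real.exp_ne_zero _), Real.log_exp, Real.log_inv, Real.log_sqrt (by positivity)]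
  ring

/-- By the chain rule the log density is a constant minus a weighted sum of squared residuals, all
of which are integrable. -/
theorem integrable_log_margPDF (hS : S.PosDef) (D : Finset (Fin d)) :
    Integrable (fun z : EuclideanSpace ℝ (Fin d) =>
      Real.log (margPDF (fun k => μ k) S D fun k => z k)) (multivariateGaussian μ S) := by
  induction D using Finset.induction with
  | empty => simp [margPDF_empty]
  | insert j D hj ih =>
    have hc := residCov_self_pos hS hj
    have hpos (z : EuclideanSpace ℝ (Fin d)) := gaussianPDFReal_pos 0
      (residCov S D j j).toNNReal (resid S D j ((fun k => z k) - fun k => μ k)) (by simpa using hc)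
    simp only [margPDF_insert hS hj, Real.log_mul (margPDF_pos hS _).ne' (hpos _).ne',
      log_gaussianPDFReal 0 hc, sub_zero]
    exact ih.add ((integrable_const _).sub ((memLp_resid D j).integrable_sq.div_const _))

theorem integrable_log_blockPDF (hS : S.PosDef) (t a b : ℕ) :
    Integrable (fun z : EuclideanSpace ℝ (Fin d) =>
      Real.log (blockPDF (fun k => μ k) S t a b fun k => z k)) (multivariateGaussian μ S) := by
  have hr (i j : ℕ) : Integrable (fun z : EuclideanSpace ℝ (Fin d) =>
      Real.log (pairRatio (fun k => μ k) S i j fun k => z k)) (multivariateGaussian μ S) := by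
    have h := fun a b (z : EuclideanSpace ℝ (Fin d)) =>
      (windowPDF_pos (m := fun k => μ k) hS a b fun k => z k).ne'
    have hi (a b : ℕ) := integrable_log_margPDF (μ := μ) hS (window d a b)
    simp only [pairRatio, Real.log_div (mul_ne_zero (h _ _ _) (h _ _ _))
      (mul_ne_zero (h _ _ _) (h _ _ _)), Real.log_mul (h _ _ _) (h _ _ _)]
    exact ((hi _ _).add (hi _ _)).sub ((hi _ _).add (hi _ _))
  have h0 (i j : ℕ) (z : EuclideanSpace ℝ (Fin d)) : (if i ≤ j ∧ j ≤ i + t then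
      pairRatio (fun k => μ k) S i j (fun k => z k) else 1) ≠ 0 := by
    split_ifs
    · exact (pairRatio_pos hS _ _ _).ne'
    · exact one_ne_zero
  simp only [blockPDF, Real.log_prod fun i _ => Finset.prod_ne_zero_iff.mpr fun j _ => h0 i j _,
    Real.log_prod fun j _ => h0 _ j _]
  refine integrable_finsetSum _ fun i _ => integrable_finsetSum _ fun j _ => ?_
  split_ifs
  · exact hr i j
  · simp

/-- The expected log density of the copula with parameter `η` for scores with correlation `ρ`. -/
def copulaScore (ρ η : ℝ) : ℝ :=
  -Real.log (1 - η ^ 2) / 2 - (η ^ 2 - η * ρ) / (1 - η ^ 2)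

/-- Apply `log x ≤ x - 1` to `x = (1 - ρ ^ 2) / (1 - η ^ 2)`. What is left over is a square, and
keeping it gives uniqueness of the maximiser as well. -/
theorem copulaScore_le {ρ η : ℝ} (hρ : ρ ∈ Set.Ioo (-1 : ℝ) 1) (hη : η ∈ Set.Ioo (-1 : ℝ) 1) :
    copulaScore ρ η + (η - ρ) ^ 2 / (2 * (1 - η ^ 2)) ≤ copulaScore ρ ρ := by
  have h1 := one_sub_sq_pos hρ
  have h2 := one_sub_sq_pos hη
  have h := Real.log_le_sub_one_of_pos (div_pos h1 h2)
  rw [Real.log_div h1.ne' h2.ne'] at h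
  have e : (1 - ρ ^ 2) / (1 - η ^ 2) - 1 =
      2 * ((η ^ 2 - η * ρ) / (1 - η ^ 2) - (η - ρ) ^ 2 / (2 * (1 - η ^ 2))) := by
    field_simp; ring
  unfold copulaScore
  rw [show ρ ^ 2 - ρ * ρ = 0 by ring, zero_div]
  linarith

theorem eq_of_copulaScore_eq {ρ η : ℝ} (hρ : ρ ∈ Set.Ioo (-1 : ℝ) 1)
    (hη : η ∈ Set.Ioo (-1 : ℝ) 1) (h : copulaScore ρ η = copulaScore ρ ρ) : η = ρ := by
  have h1 := copulaScore_le hρ hη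
  have h2 := one_sub_sq_pos hη
  have h3 : (η - ρ) ^ 2 / (2 * (1 - η ^ 2)) = 0 := le_antisymm (by linarith) (by positivity)
  rw [div_eq_zero_iff, or_iff_left (by positivity)] at h3
  exact sub_eq_zero.mp (pow_eq_zero_iff two_ne_zero |>.mp h3)

theorem copulaScore_le_self {ρ η : ℝ} (hρ : ρ ∈ Set.Ioo (-1 : ℝ) 1)
    (hη : η ∈ Set.Ioo (-1 : ℝ) 1) : copulaScore ρ η ≤ copulaScore ρ ρ := by
  have h1 := copulaScore_le hρ hη
  have h2 := one_sub_sq_pos hη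
  have : 0 ≤ (η - ρ) ^ 2 / (2 * (1 - η ^ 2)) := by positivity
  linarith

theorem memLp_stdResid (D : Finset (Fin d)) (j : Fin d) :
    MemLp (fun z : EuclideanSpace ℝ (Fin d) => stdResid (fun k => μ k) S D j fun k => z k) 2
      (multivariateGaussian μ S) := by
  simp only [stdResid, div_eq_mul_inv]
  exact (memLp_resid D j).mul_const _

theorem integral_stdResid_mul_stdResid (hS : S.PosDef) (D : Finset (Fin d)) {i : Fin d}
    (hi : i ∉ D) (j : Fin d) :
    ∫ z : EuclideanSpace ℝ (Fin d), stdResid (fun k => μ k) S D i (fun k => z k) *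
      stdResid (fun k => μ k) S D j (fun k => z k) ∂(multivariateGaussian μ S) =
      residCorr S D i j := by
  simp only [stdResid, div_mul_div_comm]
  rw [integral_div, integral_resid_mul_resid hS, residCorr,
    Real.sqrt_mul (residCov_self_pos hS hi).le]

theorem residCorr_self (hS : S.PosDef) {D : Finset (Fin d)} {i : Fin d} (hi : i ∉ D) :
    residCorr S D i i = 1 := by
  have := residCov_self_pos hS hi
  rw [residCorr, Real.sqrt_mul_self this.le, div_self this.ne']

theorem integrable_const_sub_div {α : Type*} [MeasurableSpace α] {P : Measure α}
    [IsProbabilityMeasure P] {f g h : α → ℝ} (hf : Integrable f P) (hg : Integrable g P)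
    (hh : Integrable h P) (k r s w : ℝ) :
    Integrable (fun x => k - (r * (f x + g x) - s * h x) / w) P :=
  (integrable_const k).sub ((((hf.add hg).const_mul r).sub (hh.const_mul s)).div_const w)

theorem integral_const_sub_div {α : Type*} [MeasurableSpace α] {P : Measure α}
    [IsProbabilityMeasure P] {f g h : α → ℝ} (hf : Integrable f P) (hg : Integrable g P)
    (hh : Integrable h P) (k r s w : ℝ) :
    ∫ x, (k - (r * (f x + g x) - s * h x) / w) ∂P =
      k - (r * (∫ x, f x ∂P + ∫ x, g x ∂P) - s * ∫ x, h x ∂P) / w := by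
  have h1 : Integrable (fun x => r * (f x + g x)) P := (hf.add hg).const_mul r
  have h2 : Integrable (fun x => s * h x) P := hh.const_mul s
  have h3 : Integrable (fun x => (r * (f x + g x) - s * h x) / w) P := (h1.sub h2).div_const w
  rw [integral_sub (integrable_const k) h3, integral_div, integral_sub h1 h2, integral_const_mul,
    integral_const_mul, integral_add hf hg, integral_const, probReal_univ, one_smul]

theorem log_edgeCopula_integral (hS : S.PosDef) {ρ : ℝ} (hρ : ρ ∈ Set.Ioo (-1 : ℝ) 1)
    (e : Fin d × Fin d) :
    Integrable (fun z : EuclideanSpace ℝ (Fin d) =>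
      Real.log (edgeCopula (fun k => μ k) S ρ e fun k => z k)) (multivariateGaussian μ S) ∧
    ∫ z : EuclideanSpace ℝ (Fin d), Real.log (edgeCopula (fun k => μ k) S ρ e fun k => z k)
      ∂(multivariateGaussian μ S) =
        copulaScore (residCorr S (Finset.Ioo e.1 e.2) e.1 e.2) ρ := by
  set D := Finset.Ioo e.1 e.2 with hD
  have h1 : e.1 ∉ D := by simp [hD]
  have h2 : e.2 ∉ D := by simp [hD]
  have hm (i j : Fin d) : Integrable (fun z : EuclideanSpace ℝ (Fin d) =>
      stdResid (fun k => μ k) S D i (fun k => z k) *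
      stdResid (fun k => μ k) S D j (fun k => z k)) (multivariateGaussian μ S) :=
    (memLp_stdResid D i).integrable_mul (memLp_stdResid D j)
  have hpos := one_sub_sq_pos hρ
  simp only [edgeCopula, log_scoreCopulaPDF hρ, ← hD, sq (stdResid _ _ _ _ _)]
  refine ⟨integrable_const_sub_div (hm _ _) (hm _ _) (hm _ _) _ _ _ _, ?_⟩
  rw [integral_const_sub_div (hm _ _) (hm _ _) (hm _ _), integral_stdResid_mul_stdResid hS D h1,
    integral_stdResid_mul_stdResid hS D h2, integral_stdResid_mul_stdResid hS D h1,
    residCorr_self hS h1, residCorr_self hS h2, copulaScore]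
  congr 1
  field_simp
  ring

/-- The expected log density of `N(M, v)` under a distribution whose mean is at distance `δ`
of `M` and whose variance is `w`. -/
def normalScore (w δ v : ℝ) : ℝ :=
  -Real.log (2 * Real.pi * v) / 2 - (w + δ ^ 2) / (2 * v)

theorem normalScore_le_and_eq {w δ v : ℝ} (hw : 0 < w) (hv : 0 < v) :
    normalScore w δ v ≤ normalScore w 0 w ∧
      (normalScore w δ v = normalScore w 0 w → v = w ∧ δ = 0) := by
  -- The deficit splits into a variance part, zero only at `w / v = 1`, and a mean part, zero only
  -- at `δ = 0`.
  have e : normalScore w 0 w - normalScore w δ v =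
      (w / v - 1 - Real.log (w / v)) / 2 + δ ^ 2 / (2 * v) := by
    unfold normalScore
    rw [Real.log_mul (by positivity) hv.ne', Real.log_mul (by positivity) hw.ne',
      Real.log_div hw.ne' hv.ne']
    field_simp
    ring
  have h1 := Real.log_le_sub_one_of_pos (div_pos hw hv)
  have h2 : 0 ≤ δ ^ 2 / (2 * v) := by positivity
  refine ⟨by linarith, fun h => ⟨?_, ?_⟩⟩
  · by_contra hne
    have := Real.log_lt_sub_one_of_pos (div_pos hw hv)
      (fun h => hne ((div_eq_one_iff_eq hv.ne').mp h).symm)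
    linarith
  · have h3 : δ ^ 2 / (2 * v) = 0 := by linarith
    rw [div_eq_zero_iff, or_iff_left (by positivity)] at h3
    exact pow_eq_zero_iff two_ne_zero |>.mp h3

theorem log_gaussianPDFReal_integral (hS : S.PosDef) (j : Fin d) (M : ℝ) {v : ℝ} (hv : 0 < v) :
    Integrable (fun z : EuclideanSpace ℝ (Fin d) =>
      Real.log (gaussianPDFReal M v.toNNReal (z j))) (multivariateGaussian μ S) ∧
    ∫ z : EuclideanSpace ℝ (Fin d), Real.log (gaussianPDFReal M v.toNNReal (z j))
      ∂(multivariateGaussian μ S) = normalScore (S j j) (μ j - M) v := by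
  simp only [log_gaussianPDFReal M hv]
  have hc := memLp_centered (μ := μ) (S := S) j
  have i0 : Integrable (fun z : EuclideanSpace ℝ (Fin d) => z j - μ j)
      (multivariateGaussian μ S) := hc.integrable (by norm_num)
  have i1 : Integrable (fun z : EuclideanSpace ℝ (Fin d) => (z j - μ j) * (z j - μ j))
      (multivariateGaussian μ S) := hc.integrable_mul hc
  have i2 : Integrable (fun z : EuclideanSpace ℝ (Fin d) => 2 * (μ j - M) * (z j - μ j))
      (multivariateGaussian μ S) := i0.const_mul _
  have i3 : Integrable (fun z : EuclideanSpace ℝ (Fin d) => (z j - M) ^ 2 / (2 * v))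
      (multivariateGaussian μ S) :=
    ((memLp_coord j).sub (memLp_const M)).integrable_sq.div_const _
  have i12 : Integrable (fun z : EuclideanSpace ℝ (Fin d) =>
      (z j - μ j) * (z j - μ j) + 2 * (μ j - M) * (z j - μ j)) (multivariateGaussian μ S) :=
    i1.add i2
  refine ⟨(integrable_const _).sub i3, ?_⟩
  have h0 : ∫ z : EuclideanSpace ℝ (Fin d), (z j - μ j) ∂(multivariateGaussian μ S) = 0 := by
    rw [integral_sub ((memLp_coord j).integrable (by norm_num)) (integrable_const _),
      integral_coord, integral_const, probReal_univ, one_smul, sub_self]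
  -- Expanding about the true mean yields variance plus squared bias, as the cross term integrates
  -- to zero.
  have e : ∫ z : EuclideanSpace ℝ (Fin d), (z j - M) ^ 2 ∂(multivariateGaussian μ S) =
      ∫ z : EuclideanSpace ℝ (Fin d), ((z j - μ j) * (z j - μ j) + 2 * (μ j - M) * (z j - μ j) +
        (μ j - M) ^ 2) ∂(multivariateGaussian μ S) :=
    integral_congr_ae (.of_forall fun z => by ring)
  rw [integral_sub (integrable_const _) i3, integral_const, integral_div, e,
    integral_add i12 (integrable_const _), integral_add i1 i2, integral_const_mul, h0,
    integral_centered_mul_centered hS, integral_const, probReal_univ, one_smul,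
    one_smul, mul_zero, add_zero, normalScore]

end Moments

/-! ### Solving the stepwise minimisation -/

section Minimization

variable {d : ℕ} {S : Matrix (Fin d) (Fin d) ℝ}

theorem lintegral_euclideanSpace {f : (Fin d → ℝ) → ℝ≥0∞} (hf : Measurable f) :
    ∫⁻ z : EuclideanSpace ℝ (Fin d), f (fun j => z j) = ∫⁻ x, f x :=
  (PiLp.volume_preserving_ofLp (Fin d)).lintegral_comp hf

theorem vine_eq_withDensity {ν : EuclideanSpace ℝ (Fin d)} {s : Fin d → ℝ}
    {η : Fin d → Fin d → ℝ} {τ : ℕ} {G : (Fin d → ℝ) → ℝ}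
    (h : vineDensity ν s η τ = fun z => ENNReal.ofReal (G z)) :
    vine ν s η τ = (volume : Measure (EuclideanSpace ℝ (Fin d))).withDensity
      fun z => ENNReal.ofReal (G fun j => z j) := by
  rw [vine, h]

theorem klDiv_multivariateGaussian_le_iff (hS : S.PosDef) (μ : EuclideanSpace ℝ (Fin d))
    {G G' : (Fin d → ℝ) → ℝ} (hG : Measurable G) (hG' : Measurable G') (hG0 : ∀ z, 0 < G z)
    (hG0' : ∀ z, 0 < G' z) (hG1 : ∫⁻ z, ENNReal.ofReal (G z) = 1)
    (hG1' : ∫⁻ z, ENNReal.ofReal (G' z) = 1)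
    (hGi : Integrable (fun z : EuclideanSpace ℝ (Fin d) => Real.log (G fun j => z j))
      (multivariateGaussian μ S))
    (hGi' : Integrable (fun z : EuclideanSpace ℝ (Fin d) => Real.log (G' fun j => z j))
      (multivariateGaussian μ S)) :
    klDiv (multivariateGaussian μ S) ((volume : Measure (EuclideanSpace ℝ (Fin d))).withDensity
        fun z => ENNReal.ofReal (G fun j => z j)) ≤
      klDiv (multivariateGaussian μ S) ((volume : Measure (EuclideanSpace ℝ (Fin d))).withDensity
        fun z => ENNReal.ofReal (G' fun j => z j)) ↔
    ∫ z : EuclideanSpace ℝ (Fin d), Real.log (G' fun j => z j) ∂(multivariateGaussian μ S) ≤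
      ∫ z : EuclideanSpace ℝ (Fin d), Real.log (G fun j => z j) ∂(multivariateGaussian μ S) := by
  have hofLp : Measurable fun z : EuclideanSpace ℝ (Fin d) => fun j => z j :=
    (PiLp.volume_preserving_ofLp (Fin d)).measurable
  have hfi := integrable_log_margPDF (μ := μ) hS Finset.univ
  have h1 : (multivariateGaussian μ S) Set.univ = 1 := measure_univ
  rw [multivariateGaussian_eq_withDensity μ hS] at hfi hGi hGi' h1 ⊢
  rw [withDensity_apply _ .univ, Measure.restrict_univ] at h1
  exact klDiv_withDensity_le_iff (measurable_margPDF.comp hofLp) (hG.comp hofLp) (hG'.comp hofLp)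
    (fun z => margPDF_pos hS _) (fun z => hG0 _) (fun z => hG0' _) h1
    ((lintegral_euclideanSpace hG.ennreal_ofReal).trans hG1)
    ((lintegral_euclideanSpace hG'.ennreal_ofReal).trans hG1') hfi hGi hGi'

/-- The mean-field normal density. -/
def meanFieldPDF (ν s z : Fin d → ℝ) : ℝ :=
  ∏ j, gaussianPDFReal (ν j) (s j ^ 2).toNNReal (z j)

theorem lintegral_meanFieldPDF {ν s : Fin d → ℝ} (hs : ∀ j, 0 < s j) :
    ∫⁻ z, ENNReal.ofReal (meanFieldPDF ν s z) = 1 := by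
  simp only [meanFieldPDF, ENNReal.ofReal_prod_of_nonneg fun _ _ => gaussianPDFReal_nonneg _ _ _]
  rw [lintegral_prod_eq_prod (fun j x =>
    ENNReal.ofReal (gaussianPDFReal (ν j) (s j ^ 2).toNNReal x))
    fun j => (measurable_gaussianPDFReal _ _).ennreal_ofReal]
  refine Finset.prod_eq_one fun j _ => lintegral_gaussianPDFReal_eq_one _ ?_
  have := hs j
  simp only [ne_eq, Real.toNNReal_eq_zero, not_le]
  positivity

theorem meanFieldPDF_pos {ν s : Fin d → ℝ} (hs : ∀ j, 0 < s j) (z : Fin d → ℝ) :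
    0 < meanFieldPDF ν s z :=
  Finset.prod_pos fun j _ => gaussianPDFReal_pos _ _ _ (by
    have := hs j
    simp only [ne_eq, Real.toNNReal_eq_zero, not_le]
    positivity)

theorem measurable_meanFieldPDF (ν s : Fin d → ℝ) : Measurable (meanFieldPDF ν s) :=
  Finset.measurable_prod _ fun j _ =>
    (measurable_gaussianPDFReal _ _).comp (measurable_pi_apply j)

theorem log_meanFieldPDF_integral (hS : S.PosDef) (μ : EuclideanSpace ℝ (Fin d))
    {ν s : Fin d → ℝ} (hs : ∀ j, 0 < s j) :
    Integrable (fun z : EuclideanSpace ℝ (Fin d) => Real.log (meanFieldPDF ν s fun j => z j))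
      (multivariateGaussian μ S) ∧
    ∫ z : EuclideanSpace ℝ (Fin d), Real.log (meanFieldPDF ν s fun j => z j)
      ∂(multivariateGaussian μ S) = ∑ j, normalScore (S j j) (μ j - ν j) (s j ^ 2) := by
  have hs2 (j : Fin d) : 0 < s j ^ 2 := by have := hs j; positivity
  have h0 (j : Fin d) (x : ℝ) : gaussianPDFReal (ν j) (s j ^ 2).toNNReal x ≠ 0 :=
    (gaussianPDFReal_pos _ _ _
      (by simpa only [ne_eq, Real.toNNReal_eq_zero, not_le] using hs2 j)).ne'
  simp only [meanFieldPDF, Real.log_prod fun j _ => h0 j _]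
  have h := fun j => log_gaussianPDFReal_integral (μ := μ) hS j (ν j) (hs2 j)
  refine ⟨integrable_finsetSum _ fun j _ => (h j).1, ?_⟩
  rw [integral_finsetSum _ fun j _ => (h j).1]
  exact Finset.sum_congr rfl fun j _ => (h j).2

theorem klDiv_meanField_le_iff (hS : S.PosDef) (μ : EuclideanSpace ℝ (Fin d))
    {ν ν' : EuclideanSpace ℝ (Fin d)} {s s' : Fin d → ℝ} (hs : ∀ j, 0 < s j)
    (hs' : ∀ j, 0 < s' j) (η η' : Fin d → Fin d → ℝ) :
    klDiv (multivariateGaussian μ S) (vine ν s η 0) ≤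
        klDiv (multivariateGaussian μ S) (vine ν' s' η' 0) ↔
      ∑ j, normalScore (S j j) (μ j - ν' j) (s' j ^ 2) ≤
        ∑ j, normalScore (S j j) (μ j - ν j) (s j ^ 2) := by
  have h := log_meanFieldPDF_integral hS μ (ν := fun j => ν j) hs
  have h' := log_meanFieldPDF_integral hS μ (ν := fun j => ν' j) hs'
  have hv : vineDensity ν s η 0 = fun z => ENNReal.ofReal (meanFieldPDF (fun j => ν j) s z) :=
    vineDensity_zero ν s η
  have hv' : vineDensity ν' s' η' 0 =
      fun z => ENNReal.ofReal (meanFieldPDF (fun j => ν' j) s' z) := vineDensity_zero ν' s' η'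
  rw [vine_eq_withDensity hv, vine_eq_withDensity hv', ← h.2, ← h'.2]
  exact klDiv_multivariateGaussian_le_iff hS μ (measurable_meanFieldPDF _ _)
    (measurable_meanFieldPDF _ _) (meanFieldPDF_pos hs) (meanFieldPDF_pos hs')
    (lintegral_meanFieldPDF hs) (lintegral_meanFieldPDF hs') h.1 h'.1

/-- The parameters of the first `t` trees are the partial correlations computed from `S`. -/
def MatchesTrees (S : Matrix (Fin d) (Fin d) ℝ) (η : Fin d → Fin d → ℝ) (t : ℕ) : Prop :=
  ∀ i j : Fin d, i < j → (j : ℕ) ≤ i + t → η i j = residCorr S (Finset.Ioo i j) i j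

/-- Two vines whose earlier trees match share the factor `blockPDF`, whose expected logarithm is
finite and cancels; only the edges of the new tree are compared. -/
theorem klDiv_tree_le_iff (hS : S.PosDef) (μ : EuclideanSpace ℝ (Fin d)) {s : Fin d → ℝ}
    (hs : ∀ j, s j = √(S j j)) {η η' : Fin d → Fin d → ℝ} (hη : Admissible η)
    (hη' : Admissible η') {t : ℕ} (h : MatchesTrees S η t) (h' : MatchesTrees S η' t) :
    klDiv (multivariateGaussian μ S) (vine μ s η (t + 1)) ≤
        klDiv (multivariateGaussian μ S) (vine μ s η' (t + 1)) ↔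
      ∑ e ∈ treeEdges d (t + 1),
          copulaScore (residCorr S (Finset.Ioo e.1 e.2) e.1 e.2) (η' e.1 e.2) ≤
        ∑ e ∈ treeEdges d (t + 1),
          copulaScore (residCorr S (Finset.Ioo e.1 e.2) e.1 e.2) (η e.1 e.2) := by
  let m : Fin d → ℝ := fun j => μ j
  let G : (Fin d → Fin d → ℝ) → (Fin d → ℝ) → ℝ := fun η z =>
    blockPDF m S t 0 d z * ∏ e ∈ treeEdges d (t + 1), edgeCopula m S (η e.1 e.2) e z
  have hv {η : Fin d → Fin d → ℝ} (hη : Admissible η) (h : MatchesTrees S η t) :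
      vineDensity μ s η (t + 1) = fun z => ENNReal.ofReal (G η z) :=
    vineDensity_succ hS hη (vineDensity_eq_blockPDF hS hη hs h)
  have hm (η : Fin d → Fin d → ℝ) : Measurable (G η) :=
    (measurable_blockPDF t 0 d).mul (Finset.measurable_prod _ fun e _ =>
      measurable_edgeCopula m _ e)
  have h0 {η : Fin d → Fin d → ℝ} (hη : Admissible η) (z : Fin d → ℝ) : 0 < G η z :=
    mul_pos (blockPDF_pos hS _ _ _ _) (Finset.prod_pos fun e he => edgeCopula_pos m hη he z)
  have hl {η : Fin d → Fin d → ℝ} (hη : Admissible η) (z : EuclideanSpace ℝ (Fin d)) :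
      Real.log (G η fun j => z j) = Real.log (blockPDF m S t 0 d fun j => z j) +
        ∑ e ∈ treeEdges d (t + 1), Real.log (edgeCopula m S (η e.1 e.2) e fun j => z j) := by
    rw [Real.log_mul (blockPDF_pos hS _ _ _ _).ne'
      (Finset.prod_pos fun e he => edgeCopula_pos m hη he _).ne',
      Real.log_prod fun e he => (edgeCopula_pos m hη he _).ne']
  have hb := integrable_log_blockPDF (μ := μ) hS t 0 d
  have he {η : Fin d → Fin d → ℝ} (hη : Admissible η) (e) (he : e ∈ treeEdges d (t + 1)) :=
    log_edgeCopula_integral (μ := μ) hS (hη e.1 e.2 (lt_of_mem_treeEdges he)) e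
  have hi {η : Fin d → Fin d → ℝ} (hη : Admissible η) :
      Integrable (fun z : EuclideanSpace ℝ (Fin d) => Real.log (G η fun j => z j))
        (multivariateGaussian μ S) := by
    simp only [hl hη]
    exact hb.add (integrable_finsetSum _ fun e h => (he hη e h).1)
  have hint {η : Fin d → Fin d → ℝ} (hη : Admissible η) :
      ∫ z : EuclideanSpace ℝ (Fin d), Real.log (G η fun j => z j) ∂(multivariateGaussian μ S) =
        ∫ z : EuclideanSpace ℝ (Fin d), Real.log (blockPDF m S t 0 d fun j => z j)
          ∂(multivariateGaussian μ S) + ∑ e ∈ treeEdges d (t + 1),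
          copulaScore (residCorr S (Finset.Ioo e.1 e.2) e.1 e.2) (η e.1 e.2) := by
    simp only [hl hη]
    rw [integral_add hb (integrable_finsetSum _ fun e h => (he hη e h).1),
      integral_finsetSum _ fun e h => (he hη e h).1]
    congr 1
    exact Finset.sum_congr rfl fun e h => (he hη e h).2
  rw [vine_eq_withDensity (hv hη h), vine_eq_withDensity (hv hη' h'),
    klDiv_multivariateGaussian_le_iff hS μ (hm η) (hm η') (h0 hη) (h0 hη')
      (lintegral_blockPDF_mul_edgeCopula hS m hη t) (lintegral_blockPDF_mul_edgeCopula hS m hη' t)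
      (hi hη) (hi hη'), hint hη, hint hη', add_le_add_iff_left]

theorem isStepwiseForwardKLMinimizer_residCorr (hS : S.PosDef) (μ : EuclideanSpace ℝ (Fin d)) :
    IsStepwiseForwardKLMinimizer (multivariateGaussian μ S) μ (fun j => √(S j j))
      fun i j => residCorr S (Finset.Ioo i j) i j := by
  have hadm : Admissible fun i j => residCorr S (Finset.Ioo i j) i j :=
    fun i j hij => residCorr_mem hS (by simp) (by simp) hij.ne
  refine ⟨sqrt_diag_pos hS, hadm, fun ν' s' hs' => ?_, fun t ht _ η' hη' heq => ?_⟩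
  · rw [klDiv_meanField_le_iff hS μ (sqrt_diag_pos hS) hs']
    refine Finset.sum_le_sum fun j _ => ?_
    rw [sub_self, Real.sq_sqrt hS.diag_pos.le]
    exact (normalScore_le_and_eq hS.diag_pos (by have := hs' j; positivity)).1
  · obtain ⟨t, rfl⟩ := Nat.exists_eq_add_of_le' ht
    rw [klDiv_tree_le_iff hS μ (fun _ => rfl) hadm hη' (fun _ _ _ _ => rfl)
      fun i j _ hj => heq i j (by omega)]
    refine Finset.sum_le_sum fun e he => ?_
    have hlt := lt_of_mem_treeEdges he
    exact copulaScore_le_self (hadm _ _ hlt) (hη' _ _ hlt)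

theorem eq_of_sum_le_sum {ι : Type*} {s : Finset ι} {f g : ι → ℝ} (h : ∀ i ∈ s, f i ≤ g i)
    (hs : ∑ i ∈ s, g i ≤ ∑ i ∈ s, f i) : ∀ i ∈ s, f i = g i :=
  (Finset.sum_eq_sum_iff_of_le h).mp (le_antisymm (Finset.sum_le_sum h) hs)

namespace IsStepwiseForwardKLMinimizer

variable {μ ν : EuclideanSpace ℝ (Fin d)} {s : Fin d → ℝ} {η : Fin d → Fin d → ℝ}

theorem marginals_eq (hS : S.PosDef)
    (h : IsStepwiseForwardKLMinimizer (multivariateGaussian μ S) ν s η) :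
    ν = μ ∧ ∀ j, s j = √(S j j) := by
  have h1 := h.marginals_min μ (fun j => √(S j j)) (sqrt_diag_pos hS)
  rw [klDiv_meanField_le_iff hS μ h.s_pos (sqrt_diag_pos hS)] at h1
  simp only [sub_self, Real.sq_sqrt hS.diag_pos.le] at h1
  have hs2 (j : Fin d) : 0 < s j ^ 2 := by have := h.s_pos j; positivity
  have h2 := eq_of_sum_le_sum (fun j _ => (normalScore_le_and_eq (δ := μ j - ν j)
    (hS.diag_pos (i := j)) (hs2 j)).1) h1
  have h3 (j : Fin d) := (normalScore_le_and_eq hS.diag_pos (hs2 j)).2 (h2 j (Finset.mem_univ j))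
  refine ⟨?_, fun j => ?_⟩
  · ext j
    exact (sub_eq_zero.mp (h3 j).2).symm
  · rw [← (h3 j).1, Real.sqrt_sq (h.s_pos j).le]

theorem matchesTrees (hS : S.PosDef)
    (h : IsStepwiseForwardKLMinimizer (multivariateGaussian μ S) ν s η) {t : ℕ}
    (ht : t ≤ d - 1) : MatchesTrees S η t := by
  obtain ⟨rfl, hs⟩ := h.marginals_eq hS
  induction t with
  | zero => intro i j hij hj; rw [Fin.lt_def] at hij; omega
  | succ t ih =>
    have ih := ih (by omega)
    -- The competitor changes tree `t + 1` alone, setting it to the partial correlations. As these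
    -- maximise every edge score, minimality of `η` forces equality edge by edge.
    let η' : Fin d → Fin d → ℝ := fun i j =>
      if (i : ℕ) + (t + 1) = j then residCorr S (Finset.Ioo i j) i j else η i j
    have hη' : Admissible η' := by
      intro i j hij
      simp only [η']
      split_ifs
      · exact residCorr_mem hS (by simp) (by simp) hij.ne
      · exact h.admissible i j hij
    have h' : MatchesTrees S η' t := by
      intro i j hij hj
      simp only [η', if_neg (show ¬ (i : ℕ) + (t + 1) = j by omega)]
      exact ih i j hij hj
    have h1 := h.tree_min (t + 1) (by omega) ht η' hη' fun i j hij => if_neg hij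
    rw [klDiv_tree_le_iff hS ν hs h.admissible hη' ih h'] at h1
    have h2 : ∑ e ∈ treeEdges d (t + 1), copulaScore (residCorr S (Finset.Ioo e.1 e.2) e.1 e.2)
        (η' e.1 e.2) = ∑ e ∈ treeEdges d (t + 1), copulaScore
          (residCorr S (Finset.Ioo e.1 e.2) e.1 e.2) (residCorr S (Finset.Ioo e.1 e.2) e.1 e.2) :=
      Finset.sum_congr rfl fun e he => by
        simp only [η', if_pos (mem_treeEdges.mp he)]
    rw [h2] at h1
    have hr {i j : Fin d} (hij : i < j) : residCorr S (Finset.Ioo i j) i j ∈ Set.Ioo (-1 : ℝ) 1 :=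
      residCorr_mem hS (by simp) (by simp) hij.ne
    have h3 := eq_of_sum_le_sum (fun e he => copulaScore_le_self (hr (lt_of_mem_treeEdges he))
      (h.admissible e.1 e.2 (lt_of_mem_treeEdges he))) h1
    intro i j hij hj
    by_cases hj' : (i : ℕ) + (t + 1) = j
    · exact eq_of_copulaScore_eq (hr hij) (h.admissible i j hij) (h3 (i, j) (mem_treeEdges.mpr hj'))
    · exact ih i j hij (by omega)

end IsStepwiseForwardKLMinimizer

theorem vine_eq_multivariateGaussian (hS : S.PosDef) (μ : EuclideanSpace ℝ (Fin d))
    {s : Fin d → ℝ} (hs : ∀ j, s j = √(S j j)) {η : Fin d → Fin d → ℝ} (hη : Admissible η)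
    (h : MatchesTrees S η (d - 1)) : vine μ s η (d - 1) = multivariateGaussian μ S := by
  rw [vine_eq_withDensity (vineDensity_eq_blockPDF hS hη hs h),
    multivariateGaussian_eq_withDensity μ hS]
  -- A chain of order `d - 1` on `d` coordinates is unrestricted: `d ≤ 0 + (d - 1) + 1`, which holds
  -- for `d = 0` too.
  simp only [fun z => blockPDF_eq_windowPDF (m := fun j => μ j) (z := z) (t := d - 1) (a := 0)
    (b := d) hS d (by omega) (by omega), windowPDF, window_zero]

theorem covMatrix_multivariateGaussian (hS : S.PosDef) (μ : EuclideanSpace ℝ (Fin d)) :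
    covMatrix (multivariateGaussian μ S) = S := by
  ext i j
  exact covariance_eval_multivariateGaussian hS.posSemidef i j

end Minimization

end
end GaussianDVine

/-- Stepwise minimisation of the forward Kullback-Leibler divergence over Gaussian D-vines
is solvable and recovers a Gaussian posterior `N(μ, S)` exactly. -/
theorem theorem1 (d : ℕ) (μ : EuclideanSpace ℝ (Fin d)) (S : Matrix (Fin d) (Fin d) ℝ)
    (hS : S.PosDef) :
    (∃ (ν : EuclideanSpace ℝ (Fin d)) (s : Fin d → ℝ) (η : Fin d → Fin d → ℝ),
      GaussianDVine.IsStepwiseForwardKLMinimizer (multivariateGaussian μ S) ν s η) ∧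
    ∀ (ν : EuclideanSpace ℝ (Fin d)) (s : Fin d → ℝ) (η : Fin d → Fin d → ℝ),
      GaussianDVine.IsStepwiseForwardKLMinimizer (multivariateGaussian μ S) ν s η →
      ∃ Ψ : Matrix (Fin d) (Fin d) ℝ,
        Ψ = GaussianDVine.covMatrix (GaussianDVine.vine ν s η (d - 1)) ∧
        Ψ.PosDef ∧
        GaussianDVine.vine ν s η (d - 1) = multivariateGaussian ν Ψ ∧
        ν = μ ∧
        (∀ j, s j = √(S j j)) ∧
        GaussianDVine.stdMatrix Ψ = GaussianDVine.stdMatrix S ∧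
        GaussianDVine.corrMatrix Ψ = GaussianDVine.corrMatrix S ∧
        ∀ i j : Fin d, i < j →
          η i j = GaussianDVine.partialCorr (GaussianDVine.corrMatrix S) (Finset.Ioo i j) i j := by
  refine ⟨⟨μ, _, _, GaussianDVine.isStepwiseForwardKLMinimizer_residCorr hS μ⟩,
    fun ν s η h => ?_⟩
  obtain ⟨rfl, hs⟩ := h.marginals_eq hS
  have hη := h.matchesTrees hS le_rfl
  have hq := GaussianDVine.vine_eq_multivariateGaussian hS ν hs h.admissible hη
  -- The vine is `N(ν, S)` itself, so `Ψ` can be taken to be `S` and the equalities for deviations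
  -- and correlations hold by `rfl`.
  refine ⟨S, ?_, hS, hq, rfl, hs, rfl, rfl, fun i j hij => ?_⟩
  · rw [hq, GaussianDVine.covMatrix_multivariateGaussian hS]
  · rw [GaussianDVine.partialCorr_corrMatrix hS]
    exact hη i j hij (by omega)
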